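/- Let $a=(a_{ij})_{0\le i,j\le 2}$ be a complex $3\times3$ matrix, let $$Q(x,y)=\sum_{i,j=0}^{2}a_{ij}x^iy^j,$$ and let $\mathcal C\subset\mathbb P^1\times\mathbb P^1$ be the zero set of the bihomogenization $\sum_{i,j}a_{ij}x_1^ix_0^{2-i}y_1^jy_0^{2-j}$ (with $x=x_1/x_0$, $y=y_1/y_0$). For a quartic $P=\alpha_4x^4+4\alpha_3x^3+6\alpha_2x^2+4\alpha_1x+\alpha_0$ put $$D(P)=\alpha_0\alpha_4+3\alpha_2^2-4\alpha_1\alpha_3,\qquad E(P)=\alpha_0\alpha_3^2+\alpha_1^2\alpha_4-\alpha_0\alpha_2\alpha_4-2\alpha_1\alpha_2\alpha_3+\alpha_2^3 .$$ Let $D_{\mathcal C}$ and $E_{\mathcal C}$ be the values of $D$ and $E$ at the discriminant of $Q$ regarded as a quadratic polynomial in $x$ (a polynomial in $y$ of degree at most four); the discriminant of $Q$ with respect to $y$ gives the same values. Let $\Gamma\subset\mathbb P^2$ be the cubic with affine equation $$\Gamma:\ y^2=4x^3-D_{\mathcal C}\,x+E_{\mathcal C},$$ where $[1:x:y]$ are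 the affine points, and assume that $\Gamma$ is smooth. Give $\Gamma$ the chord-tangent group law with neutral element $[0:0:1]$. Put $$X=\tfrac1{12}\bigl(a_{11}^2-4a_{12}a_{10}-4a_{21}a_{01}+8a_{02}a_{20}+8a_{22}a_{00}\bigr),\qquad Y=\det(a_{ij}).$$ Then $[1:X:Y]\in\Gamma$; let $\tau$ be the translation of $\Gamma$ that takes $[0:0:1]$ to $[1:X:Y]$. Let $h$ be the horizontal switch $(x,y)\mapsto(x_1,y)$ of $\mathcal C$, where $x,x_1$ are the two roots (with multiplicity, in $\mathbb P^1$) of $Q(\cdot,y)$, let $v$ be the vertical switch $(x,y)\mapsto(x,y_1)$ defined in the same way, and let $\delta=v\circ h:\mathcal C\to\mathcal C$ be the QRT map. If $Y\neq0$, let $$\sqrt{4x^3-D_{\mathcal C}x+E_{\mathcal C}}=C_0+C_1(x-X)+C_2(x-X)^2+\cdots$$ be the Taylor expansion at $x=X$ of the branch with value $C_0=Y$ at $X$. Consider the following condition $\mathcal K_n$ for $n\ge2$: * $\mathcal K_2$: $\det(a_{ij})=0$; * $\mathcal K_{2k+1}$ ($k\ge1$): $\det(a_{ij})\ne0$ and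 $\det\bigl(C_{2+i+j}\bigr)_{0\le i,j\le k-1}=0$ (the Hankel determinant in $C_2,\dots,C_{2k}$); * $\mathcal K_{2k}$ ($k\ge2$): $\det(a_{ij})\ne0$ and $\det\bigl(C_{3+i+j}\bigr)_{0\le i,j\le k-2}=0$ (the Hankel determinant in $C_3,\dots,C_{2k-1}$). Then the following hold. (a) For every $n$, $\delta$ has order $n$ if and only if $\tau$ has order $n$ (and $\delta$ has infinite order if and only if $\tau$ does). (b) (i) $\tau$ has order exactly $2$ if and only if $\det(a_{ij})=0$. If $\det(a_{ij})\neq0$, then (ii) for every $k\ge1$, $\tau^{2k+1}=\mathrm{id}$ if and only if $\det(C_{2+i+j})_{0\le i,j\le k-1}=0$, and (iii) for every $k\ge2$, $\tau^{2k}=\mathrm{id}$ if and only if $\det(C_{3+i+j})_{0\le i,j\le k-2}=0$. Consequently $\tau$ never has order $1$, and for every $n\ge2$ the order of $\tau$ is exactly $n$ if and only if $\mathcal K_n$ holds and $\mathcal K_m$ fails for every divisor $m$ of $n$ with $2\le m<n$. (c) Each $C_j$ is a rational function of the $a_{ij}$: for every $j\ge0$ there are polynomials $p,q$ in nine variables with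 rational coefficients such that, for every matrix $(a_{ij})$ with $\Gamma$ smooth and $\det(a_{ij})\ne0$, one has $q(a)\neq0$ and $C_j=p(a)/q(a)$. -/

import Mathlib

open Polynomial
open scoped LinearAlgebra.Projectivization

namespace Biquadratic

noncomputable section

/-! ### The biquadratic curve in the product of two projective lines

The coefficient of `x ^ i * y ^ j` is the entry `a i j` of a `3 × 3` complex matrix `a`. -/

/-- The bihomogeneous form
`Q̂(x₀, x₁, y₀, y₁) = ∑ a i j * x₁ ^ i * x₀ ^ (2 - i) * y₁ ^ j * y₀ ^ (2 - j)`. -/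
def biform (a : Matrix (Fin 3) (Fin 3) ℂ) (x y : Fin 2 → ℂ) : ℂ :=
  ∑ i : Fin 3, ∑ j : Fin 3,
    a i j * x 1 ^ (i : ℕ) * x 0 ^ (2 - (i : ℕ)) * y 1 ^ (j : ℕ) * y 0 ^ (2 - (j : ℕ))

/-- The curve `Q̂ = 0` in `ℙ¹ × ℙ¹`. -/
def curve (a : Matrix (Fin 3) (Fin 3) ℂ) :
    Set (ℙ ℂ (Fin 2 → ℂ) × ℙ ℂ (Fin 2 → ℂ)) :=
  {P | biform a P.1.rep P.2.rep = 0}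

/-- The binary quadratic form `F` is not identically zero, and its two zeros on the projective
line, counted with multiplicity, are `p` and `q`. -/
def HasRootPair (F : (Fin 2 → ℂ) → ℂ) (p q : ℙ ℂ (Fin 2 → ℂ)) : Prop :=
  ∃ c : ℂ, c ≠ 0 ∧ ∀ z : Fin 2 → ℂ,
    F z = c * (p.rep 0 * z 1 - p.rep 1 * z 0) * (q.rep 0 * z 1 - q.rep 1 * z 0)

theorem HasRootPair.right_root {F : (Fin 2 → ℂ) → ℂ} {p q : ℙ ℂ (Fin 2 → ℂ)}
    (h : HasRootPair F p q) : F q.rep = 0 := by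
  obtain ⟨c, -, hc⟩ := h
  rw [hc]
  ring

theorem eq_of_wedge_eq_zero {p q : ℙ ℂ (Fin 2 → ℂ)}
    (h : p.rep 0 * q.rep 1 - p.rep 1 * q.rep 0 = 0) : p = q := by
  rw [← p.mk_rep, ← q.mk_rep, Projectivization.mk_eq_mk_iff']
  have hp := p.rep_nonzero
  have hq := q.rep_nonzero
  by_cases h0 : q.rep 0 = 0
  · have h1 : q.rep 1 ≠ 0 := fun h1 => hq (by ext i; fin_cases i <;> simp [h0, h1])
    refine ⟨p.rep 1 / q.rep 1, ?_⟩
    have hp0 : p.rep 0 = 0 := by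
      rw [h0, mul_zero, sub_zero] at h
      exact (mul_eq_zero.1 h).resolve_right h1
    ext i
    fin_cases i
    · simp [h0, hp0]
    · simp [h1]
  · refine ⟨p.rep 0 / q.rep 0, ?_⟩
    ext i
    fin_cases i
    · simp [h0]
    · simp only [Fin.mk_one, Pi.smul_apply, smul_eq_mul]
      field_simp
      linear_combination h

/-- The second root is determined by the form and the first root. -/
theorem HasRootPair.unique {F : (Fin 2 → ℂ) → ℂ} {p q q' : ℙ ℂ (Fin 2 → ℂ)}
    (h : HasRootPair F p q) (h' : HasRootPair F p q') : q = q' := by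
  obtain ⟨c, hc, h⟩ := h
  obtain ⟨c', hc', h'⟩ := h'
  by_cases hpq : p = q'
  · -- `q'` equals `p`, so the form is a multiple of the square of the linear form of `p`
    subst hpq
    have h1 := h q.rep
    have h2 := h' q.rep
    rw [h1] at h2
    have h3 : (p.rep 0 * q.rep 1 - p.rep 1 * q.rep 0) ^ 2 = 0 := by
      have h4 : c' * (p.rep 0 * q.rep 1 - p.rep 1 * q.rep 0) ^ 2 = 0 := by
        linear_combination -h2
      exact (mul_eq_zero.1 h4).resolve_left hc'
    exact (eq_of_wedge_eq_zero (pow_eq_zero_iff two_ne_zero |>.1 h3)).symm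
  · have h1 := h q'.rep
    have h2 := h' q'.rep
    rw [h1] at h2
    have h3 : p.rep 0 * q'.rep 1 - p.rep 1 * q'.rep 0 ≠ 0 :=
      fun h0 => hpq (eq_of_wedge_eq_zero h0)
    have h4 : c * (p.rep 0 * q'.rep 1 - p.rep 1 * q'.rep 0) *
        (q.rep 0 * q'.rep 1 - q.rep 1 * q'.rep 0) = 0 := by
      linear_combination h2
    exact eq_of_wedge_eq_zero ((mul_eq_zero.1 h4).resolve_left (mul_ne_zero hc h3))

/-- A form which is not identically zero and vanishes at `p` has a second root. -/
theorem exists_hasRootPair (A B C : ℂ) (hne : ¬ (A = 0 ∧ B = 0 ∧ C = 0))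
    (p : ℙ ℂ (Fin 2 → ℂ))
    (hp : A * p.rep 1 ^ 2 + B * p.rep 1 * p.rep 0 + C * p.rep 0 ^ 2 = 0) :
    ∃ q, HasRootPair (fun z => A * z 1 ^ 2 + B * z 1 * z 0 + C * z 0 ^ 2) p q := by
  have key : ∃ (α β : ℂ), ∀ z : Fin 2 → ℂ, A * z 1 ^ 2 + B * z 1 * z 0 + C * z 0 ^ 2
      = (p.rep 0 * z 1 - p.rep 1 * z 0) * (α * z 1 - β * z 0) := by
    by_cases h0 : p.rep 0 = 0
    · have h1 : p.rep 1 ≠ 0 :=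
        fun h1 => p.rep_nonzero (by ext i; fin_cases i <;> simp [h0, h1])
      have hA : A = 0 := by
        rw [h0] at hp
        have : A * p.rep 1 ^ 2 = 0 := by linear_combination hp
        exact (mul_eq_zero.1 this).resolve_right (pow_ne_zero 2 h1)
      refine ⟨-B / p.rep 1, C / p.rep 1, fun z => ?_⟩
      rw [h0, hA]
      field_simp
      ring
    · refine ⟨A / p.rep 0, -(B * p.rep 0 + A * p.rep 1) / p.rep 0 ^ 2, fun z => ?_⟩
      field_simp
      linear_combination z 0 ^ 2 * hp
  obtain ⟨α, β, hab⟩ := key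
  have hv : ![α, β] ≠ 0 := by
    intro h
    have hα : α = 0 := congrFun h 0
    have hβ : β = 0 := congrFun h 1
    simp only [hα, hβ, zero_mul, sub_zero, mul_zero] at hab
    have hA := hab ![0, 1]
    have hC := hab ![1, 0]
    have hB := hab ![1, 1]
    simp only [Matrix.cons_val_zero, Matrix.cons_val_one] at hA hB hC
    have hA' : A = 0 := by linear_combination hA
    have hC' : C = 0 := by linear_combination hC
    exact hne ⟨hA', by linear_combination hB - hA' - hC', hC'⟩
  obtain ⟨u, hu⟩ := Projectivization.exists_smul_eq_mk_rep ℂ ![α, β] hv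
  have e0 : (Projectivization.mk ℂ ![α, β] hv).rep 0 = u * α := by rw [← hu]; rfl
  have e1 : (Projectivization.mk ℂ ![α, β] hv).rep 1 = u * β := by rw [← hu]; rfl
  refine ⟨Projectivization.mk ℂ ![α, β] hv, (u : ℂ)⁻¹, inv_ne_zero u.ne_zero, fun z => ?_⟩
  have hune : (u : ℂ) ≠ 0 := u.ne_zero
  simp only [hab, e0, e1]
  field_simp

open Classical in
/-- The horizontal switch `(x, y) ↦ (x₁, y)`, where `x, x₁` are the two roots, with multiplicity,
of `Q̂(·, y)`. (If `Q̂(·, y)` vanishes identically, so that the curve contains a horizontal line,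
which does not happen on a smooth curve, the point is left fixed by convention.) -/
def horizontalSwitch (a : Matrix (Fin 3) (Fin 3) ℂ) (P : curve a) : curve a :=
  if h : ∃ q, HasRootPair (fun z => biform a z P.1.2.rep) P.1.1 q then
    ⟨(h.choose, P.1.2), h.choose_spec.right_root⟩
  else P

open Classical in
/-- The vertical switch `(x, y) ↦ (x, y₁)`, where `y, y₁` are the two roots, with multiplicity,
of `Q̂(x, ·)`. (With the same convention if `Q̂(x, ·)` vanishes identically.) -/
def verticalSwitch (a : Matrix (Fin 3) (Fin 3) ℂ) (P : curve a) : curve a :=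
  if h : ∃ q, HasRootPair (fun z => biform a P.1.1.rep z) P.1.2 q then
    ⟨(P.1.1, h.choose), h.choose_spec.right_root⟩
  else P

/-- The QRT transformation `v ∘ h`, as an element of the monoid of self-maps of the curve
under composition. -/
def qrt (a : Matrix (Fin 3) (Fin 3) ℂ) : Function.End (curve a) :=
  verticalSwitch a ∘ horizontalSwitch a

/-! ### Projective invariants -/

/-- The Eisenstein invariant `D = a₀a₄ + 3a₂² - 4a₁a₃` of the quartic
`a₄x⁴ + 4a₃x³ + 6a₂x² + 4a₁x + a₀`. -/
def eisensteinD (P : ℂ[X]) : ℂ :=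
  P.coeff 0 * P.coeff 4 + 3 * (P.coeff 2 / 6) ^ 2 - 4 * (P.coeff 1 / 4) * (P.coeff 3 / 4)

/-- The Eisenstein invariant `E = a₀a₃² + a₁²a₄ - a₀a₂a₄ - 2a₁a₂a₃ + a₂³` of the quartic
`a₄x⁴ + 4a₃x³ + 6a₂x² + 4a₁x + a₀`. -/
def eisensteinE (P : ℂ[X]) : ℂ :=
  P.coeff 0 * (P.coeff 3 / 4) ^ 2 + (P.coeff 1 / 4) ^ 2 * P.coeff 4
    - P.coeff 0 * (P.coeff 2 / 6) * P.coeff 4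
    - 2 * (P.coeff 1 / 4) * (P.coeff 2 / 6) * (P.coeff 3 / 4) + (P.coeff 2 / 6) ^ 3

/-- The discriminant, a polynomial in `y`, of `Q` as a quadratic polynomial in `x`. -/
def discX (a : Matrix (Fin 3) (Fin 3) ℂ) : ℂ[X] :=
  (C (a 1 2) * X ^ 2 + C (a 1 1) * X + C (a 1 0)) ^ 2
    - 4 * (C (a 2 2) * X ^ 2 + C (a 2 1) * X + C (a 2 0))
      * (C (a 0 2) * X ^ 2 + C (a 0 1) * X + C (a 0 0))

/-- The discriminant, a polynomial in `x`, of `Q` as a quadratic polynomial in `y`. -/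
def discY (a : Matrix (Fin 3) (Fin 3) ℂ) : ℂ[X] := discX a.transpose

/-- The invariant `D` of the biquadratic. -/
def invD (a : Matrix (Fin 3) (Fin 3) ℂ) : ℂ := eisensteinD (discX a)

/-- The invariant `E` of the biquadratic. -/
def invE (a : Matrix (Fin 3) (Fin 3) ℂ) : ℂ := eisensteinE (discX a)

theorem discX_eq (a : Matrix (Fin 3) (Fin 3) ℂ) :
    discX a = C (a 1 2 ^ 2 - 4 * a 2 2 * a 0 2) * X ^ 4
      + C (2 * a 1 1 * a 1 2 - 4 * (a 2 2 * a 0 1 + a 2 1 * a 0 2)) * X ^ 3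
      + C (a 1 1 ^ 2 + 2 * a 1 2 * a 1 0
          - 4 * (a 2 2 * a 0 0 + a 2 1 * a 0 1 + a 2 0 * a 0 2)) * X ^ 2
      + C (2 * a 1 0 * a 1 1 - 4 * (a 2 1 * a 0 0 + a 2 0 * a 0 1)) * X
      + C (a 1 0 ^ 2 - 4 * a 2 0 * a 0 0) := by
  simp only [discX, map_add, map_sub, map_mul, map_pow, map_ofNat]
  ring

theorem discX_coeff (a : Matrix (Fin 3) (Fin 3) ℂ) :
    (discX a).coeff 0 = a 1 0 ^ 2 - 4 * a 2 0 * a 0 0 ∧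
    (discX a).coeff 1 = 2 * a 1 0 * a 1 1 - 4 * (a 2 1 * a 0 0 + a 2 0 * a 0 1) ∧
    (discX a).coeff 2 = a 1 1 ^ 2 + 2 * a 1 2 * a 1 0
          - 4 * (a 2 2 * a 0 0 + a 2 1 * a 0 1 + a 2 0 * a 0 2) ∧
    (discX a).coeff 3 = 2 * a 1 1 * a 1 2 - 4 * (a 2 2 * a 0 1 + a 2 1 * a 0 2) ∧
    (discX a).coeff 4 = a 1 2 ^ 2 - 4 * a 2 2 * a 0 2 := by
  rw [discX_eq]
  refine ⟨?_, ?_, ?_, ?_, ?_⟩ <;>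
    simp only [coeff_add, coeff_C_mul, coeff_X_pow, coeff_X, coeff_C] <;> norm_num

/-- The two discriminants have the same invariants. -/
theorem invD_eq_discY (a : Matrix (Fin 3) (Fin 3) ℂ) : invD a = eisensteinD (discY a) := by
  obtain ⟨h0, h1, h2, h3, h4⟩ := discX_coeff a
  obtain ⟨k0, k1, k2, k3, k4⟩ := discX_coeff a.transpose
  rw [invD, discY, eisensteinD, eisensteinD, h0, h1, h2, h3, h4, k0, k1, k2, k3, k4]
  simp only [Matrix.transpose_apply]
  ring

theorem invE_eq_discY (a : Matrix (Fin 3) (Fin 3) ℂ) : invE a = eisensteinE (discY a) := by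
  obtain ⟨h0, h1, h2, h3, h4⟩ := discX_coeff a
  obtain ⟨k0, k1, k2, k3, k4⟩ := discX_coeff a.transpose
  rw [invE, discY, eisensteinE, eisensteinE, h0, h1, h2, h3, h4, k0, k1, k2, k3, k4]
  simp only [Matrix.transpose_apply]
  ring

/-! ### The cubic curve in the projective plane -/

/-- The homogeneous equation `x₀x₂² - 4x₁³ + D x₀²x₁ - E x₀³` of the cubic
`Γ : y² = 4x³ - D x + E`, with `x = x₁ / x₀` and `y = x₂ / x₀`. -/
def cubicForm (a : Matrix (Fin 3) (Fin 3) ℂ) : MvPolynomial (Fin 3) ℂ :=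
  MvPolynomial.X 0 * MvPolynomial.X 2 ^ 2 - 4 * MvPolynomial.X 1 ^ 3
    + MvPolynomial.C (invD a) * MvPolynomial.X 0 ^ 2 * MvPolynomial.X 1
    - MvPolynomial.C (invE a) * MvPolynomial.X 0 ^ 3

/-- The cubic `Γ` as a subset of `ℙ²`. -/
def cubic (a : Matrix (Fin 3) (Fin 3) ℂ) : Set (ℙ ℂ (Fin 3 → ℂ)) :=
  {p | MvPolynomial.eval p.rep (cubicForm a) = 0}

/-- The cubic `Γ` is smooth: the partial derivatives of its equation have no common zero on it. -/
def IsSmoothCubic (a : Matrix (Fin 3) (Fin 3) ℂ) : Prop :=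
  ∀ v : Fin 3 → ℂ, v ≠ 0 → MvPolynomial.eval v (cubicForm a) = 0 →
    ∃ i, MvPolynomial.eval v (MvPolynomial.pderiv i (cubicForm a)) ≠ 0

/-- The coordinate `X` of the translation point. -/
def ptX (a : Matrix (Fin 3) (Fin 3) ℂ) : ℂ :=
  (a 1 1 ^ 2 - 4 * a 1 2 * a 1 0 - 4 * a 2 1 * a 0 1 + 8 * a 0 2 * a 2 0
    + 8 * a 2 2 * a 0 0) / 12

/-- The coordinate `Y` of the translation point. -/
def ptY (a : Matrix (Fin 3) (Fin 3) ℂ) : ℂ := a.det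

theorem ptY_sq (a : Matrix (Fin 3) (Fin 3) ℂ) :
    ptY a ^ 2 = 4 * ptX a ^ 3 - invD a * ptX a + invE a := by
  obtain ⟨h0, h1, h2, h3, h4⟩ := discX_coeff a
  rw [ptY, ptX, invD, invE, eisensteinD, eisensteinE, h0, h1, h2, h3, h4, Matrix.det_fin_three]
  ring

theorem cubicForm_eval (a : Matrix (Fin 3) (Fin 3) ℂ) (v : Fin 3 → ℂ) :
    MvPolynomial.eval v (cubicForm a)
      = v 0 * v 2 ^ 2 - 4 * v 1 ^ 3 + invD a * v 0 ^ 2 * v 1 - invE a * v 0 ^ 3 := by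
  simp [cubicForm]

theorem mk_mem_cubic (a : Matrix (Fin 3) (Fin 3) ℂ) (v : Fin 3 → ℂ) (hv : v ≠ 0) :
    Projectivization.mk ℂ v hv ∈ cubic a ↔
      v 0 * v 2 ^ 2 - 4 * v 1 ^ 3 + invD a * v 0 ^ 2 * v 1 - invE a * v 0 ^ 3 = 0 := by
  obtain ⟨u, hu⟩ := Projectivization.exists_smul_eq_mk_rep ℂ v hv
  have hune : (u : ℂ) ≠ 0 := u.ne_zero
  have e : ∀ i, (Projectivization.mk ℂ v hv).rep i = u * v i := fun i => by rw [← hu]; rfl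
  rw [cubic, Set.mem_ofPred_eq, cubicForm_eval, e, e, e]
  have : (u * v 0 * (u * v 2) ^ 2 - 4 * (u * v 1) ^ 3 + invD a * (u * v 0) ^ 2 * (u * v 1)
      - invE a * (u * v 0) ^ 3 : ℂ)
      = u ^ 3 * (v 0 * v 2 ^ 2 - 4 * v 1 ^ 3 + invD a * v 0 ^ 2 * v 1 - invE a * v 0 ^ 3) := by
    ring
  rw [this, mul_eq_zero, or_iff_right (pow_ne_zero 3 hune)]

/-- The point `[1 : x : y]` of the projective plane. -/
def affinePoint (x y : ℂ) : ℙ ℂ (Fin 3 → ℂ) :=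
  Projectivization.mk ℂ ![1, x, y] (fun h => one_ne_zero (congrFun h 0))

/-- The point `[0 : 0 : 1]` of the projective plane. -/
def infinityPoint : ℙ ℂ (Fin 3 → ℂ) :=
  Projectivization.mk ℂ ![0, 0, 1] (fun h => one_ne_zero (congrFun h 2))

theorem affinePoint_mem (a : Matrix (Fin 3) (Fin 3) ℂ) (x y : ℂ) :
    affinePoint x y ∈ cubic a ↔ y ^ 2 = 4 * x ^ 3 - invD a * x + invE a := by
  rw [affinePoint, mk_mem_cubic]
  simp only [Matrix.cons_val]
  constructor <;> intro h <;> linear_combination h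

theorem infinityPoint_mem (a : Matrix (Fin 3) (Fin 3) ℂ) : infinityPoint ∈ cubic a := by
  rw [infinityPoint, mk_mem_cubic]
  simp

/-- The Weierstrass model `η² = x³ - (D / 4) x + E / 4` of `Γ`, obtained by `y = 2η`. -/
def weierstrass (a : Matrix (Fin 3) (Fin 3) ℂ) : WeierstrassCurve.Affine ℂ :=
  { a₁ := 0, a₂ := 0, a₃ := 0, a₄ := -invD a / 4, a₆ := invE a / 4 }

theorem weierstrass_equation (a : Matrix (Fin 3) (Fin 3) ℂ) (x η : ℂ) :
    (weierstrass a).Equation x η ↔ (2 * η) ^ 2 = 4 * x ^ 3 - invD a * x + invE a := by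
  rw [WeierstrassCurve.Affine.equation_iff]
  simp only [weierstrass]
  constructor <;> intro h
  · linear_combination 4 * h
  · linear_combination h / 4

theorem weierstrass_nonsingular (a : Matrix (Fin 3) (Fin 3) ℂ) (hs : IsSmoothCubic a) (x η : ℂ)
    (h : (weierstrass a).Equation x η) : (weierstrass a).Nonsingular x η := by
  have h' := (weierstrass_equation a x η).1 h
  rw [WeierstrassCurve.Affine.nonsingular_iff']
  refine ⟨h, ?_⟩
  by_contra! hcon
  obtain ⟨h1, h2⟩ := hcon
  simp only [weierstrass] at h1 h2
  have hη : η = 0 := by linear_combination h2 / 2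
  subst hη
  obtain ⟨i, hi⟩ := hs ![1, x, 0] (fun h => one_ne_zero (congrFun h 0)) (by
    rw [cubicForm_eval]
    simp only [Matrix.cons_val]
    linear_combination h')
  apply hi
  have e4 : (4 : MvPolynomial (Fin 3) ℂ) = MvPolynomial.C 4 :=
    (map_ofNat MvPolynomial.C 4).symm
  fin_cases i <;>
    simp [cubicForm, e4, MvPolynomial.pderiv_X, Derivation.leibniz_pow]
  · linear_combination 3 * h' - 4 * x * h1
  · linear_combination 4 * h1

/-- The linear change of coordinates from the Weierstrass model to `Γ`:
`(x, η) ↦ [1 : x : 2η]`, and the point at infinity goes to `[0 : 0 : 1]`. -/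
def toCubic (a : Matrix (Fin 3) (Fin 3) ℂ) : (weierstrass a).Point → cubic a
  | .zero => ⟨infinityPoint, infinityPoint_mem a⟩
  | .some x η h =>
      ⟨affinePoint x (2 * η), (affinePoint_mem a _ _).2 ((weierstrass_equation a x η).1 h.1)⟩

theorem toCubic_bijective (a : Matrix (Fin 3) (Fin 3) ℂ) (hs : IsSmoothCubic a) :
    Function.Bijective (toCubic a) := by
  constructor
  · rintro (_ | ⟨x, η, h⟩) (_ | ⟨x', η', h'⟩) he
    · rfl
    · have := Subtype.ext_iff.1 he
      simp only [toCubic, infinityPoint, affinePoint, Projectivization.mk_eq_mk_iff'] at this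
      obtain ⟨u, hu⟩ := this
      have h0 := congrFun hu 0
      have h2 := congrFun hu 2
      simp at h0 h2
      simp [h0] at h2
    · have := Subtype.ext_iff.1 he
      simp only [toCubic, infinityPoint, affinePoint, Projectivization.mk_eq_mk_iff'] at this
      obtain ⟨u, hu⟩ := this
      have h0 := congrFun hu 0
      simp at h0
    · have := Subtype.ext_iff.1 he
      simp only [toCubic, affinePoint, Projectivization.mk_eq_mk_iff'] at this
      obtain ⟨u, hu⟩ := this
      have h0 := congrFun hu 0
      have h1 := congrFun hu 1
      have h2 := congrFun hu 2
      simp at h0 h1 h2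
      subst h0
      have hx : x = x' := by linear_combination -h1
      have hη : η = η' := by linear_combination -h2 / 2
      subst hx hη
      rfl
  · rintro ⟨p, hp⟩
    induction p with
    | h v hv =>
      have hm := (mk_mem_cubic a v hv).1 hp
      by_cases h0 : v 0 = 0
      · have h1 : v 1 = 0 := by
          rw [h0] at hm
          have : v 1 ^ 3 = 0 := by linear_combination -hm / 4
          exact (pow_eq_zero_iff three_ne_zero).1 this
        have h2 : v 2 ≠ 0 := fun h2 => hv (by ext i; fin_cases i <;> simp [h0, h1, h2])
        refine ⟨.zero, Subtype.ext ?_⟩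
        simp only [toCubic, infinityPoint, Projectivization.mk_eq_mk_iff']
        refine ⟨(v 2)⁻¹, ?_⟩
        ext i
        fin_cases i <;> simp [h0, h1, h2]
      · have heq : (weierstrass a).Equation (v 1 / v 0) (v 2 / v 0 / 2) := by
          rw [weierstrass_equation]
          field_simp
          linear_combination hm
        refine ⟨.some _ _ (weierstrass_nonsingular a hs _ _ heq), Subtype.ext ?_⟩
        simp only [toCubic, affinePoint, Projectivization.mk_eq_mk_iff']
        refine ⟨(v 0)⁻¹, ?_⟩
        ext i
        fin_cases i
        · simp [h0]
        · simp [div_eq_inv_mul]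
        · simp
          field_simp

/-- The chord-tangent group law on the smooth cubic `Γ` with `[0 : 0 : 1]` as zero:
a linear change of coordinates identifies `Γ` with the points of its Weierstrass model. -/
@[reducible] def cubicAddCommGroup (a : Matrix (Fin 3) (Fin 3) ℂ) (hs : IsSmoothCubic a) :
    AddCommGroup (cubic a) :=
  (Equiv.ofBijective (toCubic a) (toCubic_bijective a hs)).symm.addCommGroup

/-- The point `[1 : X : Y]` of `Γ`. -/
def translationPoint (a : Matrix (Fin 3) (Fin 3) ℂ) : cubic a :=
  ⟨affinePoint (ptX a) (ptY a), (affinePoint_mem a _ _).2 (ptY_sq a)⟩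

/-- The translation of `Γ`, for its group law, that takes `[0 : 0 : 1]` to `[1 : X : Y]`. -/
def translation (a : Matrix (Fin 3) (Fin 3) ℂ) (hs : IsSmoothCubic a) :
    Equiv.Perm (cubic a) :=
  letI := cubicAddCommGroup a hs
  Equiv.addRight (translationPoint a)

theorem translation_infinityPoint (a : Matrix (Fin 3) (Fin 3) ℂ) (hs : IsSmoothCubic a) :
    translation a hs ⟨infinityPoint, infinityPoint_mem a⟩ = translationPoint a := by
  let := cubicAddCommGroup a hs
  have h0 : (⟨infinityPoint, infinityPoint_mem a⟩ : cubic a) = 0 := rfl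
  change (⟨infinityPoint, infinityPoint_mem a⟩ : cubic a) + translationPoint a = _
  rw [h0, zero_add]

/-! ### Taylor coefficients and Hankel determinants -/

/-- For `Y ≠ 0`, the branch of `√(4x³ - D x + E)` near `x = X` whose value at `X` is `Y`. -/
def sqrtBranch (a : Matrix (Fin 3) (Fin 3) ℂ) (x : ℂ) : ℂ :=
  ptY a * ((4 * x ^ 3 - invD a * x + invE a) / ptY a ^ 2) ^ (1 / 2 : ℂ)

theorem sqrtBranch_spec (a : Matrix (Fin 3) (Fin 3) ℂ) (h : ptY a ≠ 0) :
    AnalyticAt ℂ (sqrtBranch a) (ptX a) ∧ sqrtBranch a (ptX a) = ptY a ∧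
      ∀ x, sqrtBranch a x ^ 2 = 4 * x ^ 3 - invD a * x + invE a := by
  have hX : (4 * ptX a ^ 3 - invD a * ptX a + invE a) / ptY a ^ 2 = 1 := by
    rw [← ptY_sq, div_self (pow_ne_zero 2 h)]
  refine ⟨?_, ?_, fun x => ?_⟩
  · unfold sqrtBranch
    refine analyticAt_const.mul (AnalyticAt.cpow ?_ analyticAt_const ?_)
    · fun_prop
    · rw [hX]
      exact Complex.one_mem_slitPlane
  · rw [sqrtBranch, hX, Complex.one_cpow, mul_one]
  · rw [sqrtBranch, mul_pow, ← Complex.cpow_nat_mul]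
    norm_num
    field_simp

/-- The Taylor coefficient `C_j` of `√(4x³ - D x + E)` at the point `[1 : X : Y]` of `Γ`. -/
def taylorCoeff (a : Matrix (Fin 3) (Fin 3) ℂ) (j : ℕ) : ℂ :=
  iteratedDeriv j (sqrtBranch a) (ptX a) / (j.factorial : ℂ)

/-- The determinant of the `m × m` Hankel matrix with first row `C_s, C_{s+1}, …, C_{s+m-1}`
and last row `C_{s+m-1}, …, C_{s+2m-2}`. -/
def hankelDet (a : Matrix (Fin 3) (Fin 3) ℂ) (s m : ℕ) : ℂ :=
  (Matrix.of fun i j : Fin m => taylorCoeff a (s + (i : ℕ) + (j : ℕ))).det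

/-- The determinantal condition of index `n`: `det (a i j) = 0` for `n = 2`; and, at a point with
`Y = det (a i j) ≠ 0`, where the Taylor coefficients exist, the vanishing of the Hankel
determinant in `C_2, …, C_{2k}` for `n = 2k + 1`, `k ≥ 1`, and of the Hankel determinant in
`C_3, …, C_{2k-1}` for `n = 2k`, `k ≥ 2`. -/
def CayleyCondition (a : Matrix (Fin 3) (Fin 3) ℂ) (n : ℕ) : Prop :=
  (n = 2 ∧ a.det = 0) ∨
  (∃ k, 1 ≤ k ∧ n = 2 * k + 1 ∧ a.det ≠ 0 ∧ hankelDet a 2 k = 0) ∨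
  (∃ k, 2 ≤ k ∧ n = 2 * k ∧ a.det ≠ 0 ∧ hankelDet a 3 (k - 1) = 0)

end

end Biquadratic

/-!
The curve `𝒞` is a torsor under the elliptic curve `Γ`, and the QRT map is translation by the point
`T = [1 : X : Y]`; its order is therefore that of `T`, to which Cayley's criterion applies.

*The QRT map.* Unimodular changes of coordinates on the two lines conjugate the switches, and leave
`D`, `E`, `X` and `Y` unchanged (`curveEquiv_qrt_pow`, `discX_pullX`). The discriminant with respect
to `x` has a zero on the line of `y`, which gives a fixed point of the horizontal switch; it is moved
to `(∞, ∞)` (`exists_isNormalForm_pullback`). On the curve in this normal form the discriminant is a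
cubic polynomial in `y`, so that `y` and the derivative of the form with respect to `x`, a square
root of the discriminant, are up to affine changes the coordinates of a point of `Γ`. This map
`IsNormalForm.toWeierstrass` is injective. It turns the horizontal switch into `P ↦ -P`, because the
two roots `x` have opposite derivatives, and the vertical switch into `P ↦ T - P`, because points of
the curve with the same `x` go to points of a line through `-T`. Their composite is translation
by `T`.

*Cayley's criterion.* For a point `T = (x, y)` of a Weierstrass curve with `T ≠ -T`, embedding the
group of points in the class group of the coordinate ring shows that `n T = 0` exactly when the
`n`-th power of the ideal of `T` is principal. Norms to the polynomial ring in `X` show that a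
generator is the same as a nonzero function `p + q Y` with a pole of order at most `n` at infinity
that vanishes to order `n` at `T` (`nsmul_some_eq_zero_iff_exists_expand`). In terms of the expansion
`c` of `Y` in powers of `X - x`, this asks for polynomials `p`, `q` of bounded degree such that
`p + q c` vanishes to one order more than the number of free coefficients guarantees, which is the
vanishing of a Hankel determinant (`PowerSeries.exists_pade_iff_det_eq_zero`).

*Rationality.* The square of the series with coefficients `C_j` is a polynomial with coefficients
rational in the matrix entries, so that the `C_j` satisfy a recursion with denominator `2 Y`.
-/

/-! ### Torsion points of a Weierstrass curve -/

theorem Ideal.dvd_of_mul_eq_span {R : Type*} [CommRing R] {I J : Ideal R} {a f : R}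
    (h : J * I = span {a}) (hI : I = span {f}) : f ∣ a := by
  rw [← mem_span_singleton, ← hI]
  exact mul_le_right (h ▸ mem_span_singleton_self a)

/-- If a product of two ideals is generated by the product of an element of each of them, then the
ideals are generated by these elements. -/
theorem Ideal.eq_span_of_mul_eq_span {R : Type*} [CommRing R] [IsDomain R] {I J : Ideal R}
    {a f g : R} (h : J * I = span {a}) (hf : f ∈ I) (hg : g ∈ J) (hg0 : g ≠ 0) {u v : R}
    (huv : u * v = 1) (hfg : f * g = a * u) : I = span {f} := by
  refine le_antisymm (fun w hw => ?_) ((span_singleton_le_iff_mem _).2 hf)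
  have h1 : g * w ∈ span {a} := h ▸ mul_mem_mul hg hw
  obtain ⟨s, hs⟩ := mem_span_singleton.1 h1
  rw [mem_span_singleton]
  refine ⟨v * s, mul_left_cancel₀ hg0 ?_⟩
  rw [hs]
  linear_combination (-s * a) * huv - v * s * hfg

theorem Ideal.mem_of_mul_eq_span {R : Type*} [CommRing R] {I J : Ideal R} {a b u : R}
    (h : J * I = span {a}) (hb : b = a * u) : b ∈ I ∧ b ∈ J := by
  have : b ∈ J * I := h ▸ hb ▸ mul_mem_right u _ (mem_span_singleton_self a)
  exact ⟨mul_le_right this, mul_le_left this⟩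

namespace WeierstrassCurve.Affine

open CoordinateRing
open scoped Polynomial.Bivariate

noncomputable section

namespace CoordinateRing

variable {F : Type*} [Field F] {W : Affine F}

/-- The ring homomorphism `F[X] → F⟦t⟧` that substitutes `x + t` for `X`. -/
def taylorSeries (x : F) : F[X] →+* PowerSeries F :=
  Polynomial.coeToPowerSeries.ringHom.comp (taylorAlgHom x : F[X] →+* F[X])

theorem taylorSeries_apply (x : F) (p : F[X]) :
    taylorSeries x p = ((taylor x p : F[X]) : PowerSeries F) := rfl

theorem taylorSeries_X_sub_C (x : F) : taylorSeries x (X - C x) = PowerSeries.X := by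
  simp [taylorSeries_apply]

theorem X_pow_dvd_taylorSeries_iff (x : F) (p : F[X]) (n : ℕ) :
    (PowerSeries.X : PowerSeries F) ^ n ∣ taylorSeries x p ↔ (X - C x) ^ n ∣ p := by
  constructor
  · intro h
    have h1 : (X : F[X]) ^ n ∣ taylor x p := by
      rw [Polynomial.X_pow_dvd_iff]
      intro d hd
      have := PowerSeries.X_pow_dvd_iff.1 h d hd
      rwa [taylorSeries_apply, Polynomial.coeff_coe] at this
    obtain ⟨q, hq⟩ := h1
    refine ⟨taylor (-x) q, ?_⟩
    have := congrArg (taylor (-x)) hq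
    rw [taylor_taylor, neg_add_cancel, taylor_zero] at this
    rw [this, taylor_mul, taylor_pow, taylor_X]
    simp [sub_eq_add_neg]
  · intro h
    simpa [taylorSeries_X_sub_C] using map_dvd (taylorSeries x) h

/-- Expansion at a point: the ring homomorphism `F[W] → F⟦t⟧` given by `X ↦ x + t`, `Y ↦ c`, where
`c` is a power series solution of the equation of the curve. -/
def expand (x : F) (c : PowerSeries F) (hc : W.polynomial.eval₂ (taylorSeries x) c = 0) :
    W.CoordinateRing →+* PowerSeries F :=
  AdjoinRoot.lift (taylorSeries x) c hc

theorem expand_mk (x : F) (c : PowerSeries F) (hc : W.polynomial.eval₂ (taylorSeries x) c = 0)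
    (P : F[X][Y]) : expand x c hc (mk W P) = P.eval₂ (taylorSeries x) c :=
  AdjoinRoot.lift_mk hc P

theorem expand_smul_basis (x : F) (c : PowerSeries F)
    (hc : W.polynomial.eval₂ (taylorSeries x) c = 0) (p q : F[X]) :
    expand x c hc (p • 1 + q • mk W Y) = taylorSeries x p + taylorSeries x q * c := by
  rw [smul, smul, mul_one, ← map_mul, ← map_add, expand_mk]
  simp

theorem X_pow_dvd_expand {x y : F} {c : PowerSeries F}
    (hc : W.polynomial.eval₂ (taylorSeries x) c = 0) (hy : PowerSeries.constantCoeff c = y)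
    {n : ℕ} {f : W.CoordinateRing} (hf : f ∈ XYIdeal W x (C y) ^ n) :
    PowerSeries.X ^ n ∣ expand x c hc f := by
  have h1 : Ideal.map (expand x c hc) (XYIdeal W x (C y)) ≤ Ideal.span {PowerSeries.X} := by
    rw [XYIdeal, Ideal.map_span, Ideal.span_le]
    rintro _ ⟨u, rfl | rfl, rfl⟩
    · rw [XClass, expand_mk, eval₂_C, taylorSeries_X_sub_C]
      exact Ideal.mem_span_singleton_self _
    · rw [YClass, expand_mk, SetLike.mem_coe, Ideal.mem_span_singleton, PowerSeries.X_dvd_iff]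
      simp [hy, taylorSeries_apply]
  have h2 := Ideal.mem_map_of_mem (expand x c hc) hf
  rw [Ideal.map_pow] at h2
  have h3 := Ideal.pow_right_mono h1 n h2
  rwa [Ideal.span_singleton_pow, Ideal.mem_span_singleton] at h3

theorem smul_basis_mem_XYIdeal {x y : F} (h : W.Equation x y) (p q : F[X]) :
    p • (1 : W.CoordinateRing) + q • mk W Y ∈ XYIdeal W x (C y) ↔
      p.eval x + q.eval x * y = 0 := by
  rw [smul, smul, mul_one, ← map_mul, ← map_add]
  have h1 : XYIdeal W x (C y) = Ideal.map (mk W)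
      (Ideal.span {C (X - C x), Y - C (C y)}) := by
    rw [Ideal.map_span, XYIdeal, XClass, YClass, Set.image_pair]
  have hker : RingHom.ker (mk W) ≤ Ideal.span {C (X - C x), Y - C (C y)} := by
    intro u hu
    rw [RingHom.mem_ker, AdjoinRoot.mk_eq_zero] at hu
    refine Ideal.mem_of_dvd _ hu ?_
    rw [mem_span_C_X_sub_C_X_sub_C_iff_eval_eval_eq_zero]
    exact h
  rw [h1, Ideal.mem_map_iff_of_surjective (mk W) AdjoinRoot.mk_surjective]
  constructor
  · rintro ⟨u, hu, hu'⟩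
    have h3 : C p + C q * Y - u ∈ Ideal.span {C (X - C x), Y - C (C y)} := by
      apply hker
      rw [RingHom.mem_ker, map_sub, hu', sub_self]
    have h4 := add_mem h3 hu
    rw [sub_add_cancel, mem_span_C_X_sub_C_X_sub_C_iff_eval_eval_eq_zero] at h4
    simpa using h4
  · intro h3
    refine ⟨_, ?_, rfl⟩
    rw [mem_span_C_X_sub_C_X_sub_C_iff_eval_eval_eq_zero]
    simpa using h3

theorem XYIdeal_isMaximal {x y : F} (h : W.Equation x y) :
    (XYIdeal W x (C y)).IsMaximal := by
  have e := quotientXYIdealEquiv (W' := W) (x := x) (y := C y) h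
  exact Ideal.Quotient.maximal_of_isField _
    (MulEquiv.isField (Field.toIsField F) e.toMulEquiv)

/-- Membership in a power of the ideal of a point is not affected by a factor which does not vanish
at the point. -/
theorem mem_XYIdeal_pow_of_mul_mem {x y : F} (h : W.Equation x y) {n : ℕ} (hn : n ≠ 0)
    {f g : W.CoordinateRing} (hfg : f * g ∈ XYIdeal W x (C y) ^ n)
    (hg : g ∉ XYIdeal W x (C y)) : f ∈ XYIdeal W x (C y) ^ n := by
  have hm := XYIdeal_isMaximal h
  have hr : (XYIdeal W x (C y) ^ n).radical = XYIdeal W x (C y) := by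
    rw [Ideal.radical_pow _ hn, hm.isPrime.radical]
  have hp : (XYIdeal W x (C y) ^ n).IsPrimary :=
    Ideal.isPrimary_of_isMaximal_radical (by rwa [hr])
  rcases (Ideal.isPrimary_iff.1 hp).2 hfg with h1 | h1
  · exact h1
  · rw [hr] at h1
    exact absurd h1 hg

/-- The function `p + q Y` times its conjugate `p - q (a₁ X + a₃) - q Y` is its norm. -/
theorem mul_conj_eq_norm (p q : F[X]) :
    (p • (1 : W.CoordinateRing) + q • mk W Y) *
      ((p - q * (C W.a₁ * X + C W.a₃)) • (1 : W.CoordinateRing) + (-q) • mk W Y) =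
      mk W (C (Algebra.norm F[X] (p • (1 : W.CoordinateRing) + q • mk W Y))) := by
  have e (r s : F[X]) : r • (1 : W.CoordinateRing) + s • mk W Y = mk W (C r + C s * Y) := by
    rw [smul, smul, mul_one, ← map_mul, ← map_add]
  have h := coe_norm_smul_basis (W' := W) p q
  rw [AdjoinRoot.mk_C, h, e, e, ← map_mul]
  refine congrArg (mk W) ?_
  simp only [map_sub, map_mul, map_neg, map_add]
  ring

theorem mk_C_injective : Function.Injective fun p : F[X] => mk W (C p) := by
  intro p q hpq
  have h : (p - q) • (1 : W.CoordinateRing) + (0 : F[X]) • mk W Y = 0 := by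
    simp only [smul, mul_one, map_sub, map_zero, zero_mul, add_zero]
    exact sub_eq_zero.2 hpq
  exact sub_eq_zero.1 (smul_basis_eq_zero h).1

theorem XYIdeal_pow_mul_pow {x y : F} (h : W.Nonsingular x y) (n : ℕ) :
    XYIdeal W x (C (W.negY x y)) ^ n * XYIdeal W x (C y) ^ n =
      Ideal.span {mk W (C ((X - C x) ^ n))} := by
  rw [← mul_pow, XYIdeal_neg_mul h, XIdeal, Ideal.span_singleton_pow, XClass, map_pow, map_pow]

/-- A generator of the `n`-th power of the ideal of a point which is not fixed by negation has norm
of degree at most `n`, that is, a pole of order at most `n` at infinity. -/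
theorem degree_norm_le_of_span_eq {x y : F} (h : W.Nonsingular x y) (hy : y ≠ W.negY x y)
    {n : ℕ} {f : W.CoordinateRing} (hf : XYIdeal W x (C y) ^ n = Ideal.span {f}) :
    (Algebra.norm F[X] f).degree ≤ n := by
  -- `f` divides `(X - x) ^ n`
  obtain ⟨g, hg⟩ : f ∣ mk W (C ((X - C x) ^ n)) :=
    Ideal.dvd_of_mul_eq_span (XYIdeal_pow_mul_pow h n) hf
  have hN : Algebra.norm F[X] f ∣ (X - C x) ^ (n * 2) := by
    refine ⟨Algebra.norm F[X] g, ?_⟩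
    rw [← map_mul, ← hg]
    have h2 := norm_smul_basis (W' := W) ((X - C x) ^ n) 0
    simp only [zero_smul, add_zero, smul, mul_one] at h2
    rw [h2]
    ring
  obtain ⟨i, -, u, hu⟩ := (dvd_prime_pow (prime_X_sub_C x) _).1 hN
  rw [degree_eq_degree_of_associated ⟨u, hu⟩, degree_pow, degree_X_sub_C, nsmul_one]
  by_contra! hlt
  have hni : n < i := by exact_mod_cast hlt
  obtain ⟨p, q, hpq⟩ := exists_smul_basis_eq f
  -- otherwise the conjugate of `f`, hence `f` itself, is divisible by `X - x`
  have hconj := mul_conj_eq_norm (W := W) p q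
  rw [hpq] at hconj
  generalize Algebra.norm F[X] f = N at *
  have hf0 : f ≠ 0 := by
    rintro h0
    rw [h0, zero_mul] at hg
    exact pow_ne_zero n (X_sub_C_ne_zero x) (mk_C_injective (W := W) (hg.trans (by simp)))
  have hNeq : N = (X - C x) ^ n * ((X - C x) ^ (i - n) * (↑u⁻¹ : F[X])) := by
    rw [← mul_assoc, ← pow_add, Nat.add_sub_cancel' hni.le, ← hu, mul_assoc, Units.mul_inv, mul_one]
  obtain ⟨j, hj⟩ : ∃ j, i - n = j + 1 := ⟨i - n - 1, by omega⟩
  rw [hNeq, map_mul, map_mul, hg, mul_assoc] at hconj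
  have h3 := mul_left_cancel₀ hf0 hconj
  obtain ⟨k₁, k₂, hk⟩ := exists_smul_basis_eq (g * mk W (C ((X - C x) ^ j * (↑u⁻¹ : F[X]))))
  have h4 : g * mk W (C ((X - C x) ^ (i - n) * (↑u⁻¹ : F[X]))) =
      ((X - C x) * k₁) • (1 : W.CoordinateRing) + ((X - C x) * k₂) • mk W Y := by
    rw [hj, mul_smul, mul_smul, ← smul_add, hk, smul]
    simp only [map_mul, map_pow]
    ring
  rw [h4, ← sub_eq_zero] at h3
  have h5 : (p - q * (C W.a₁ * X + C W.a₃) - (X - C x) * k₁) • (1 : W.CoordinateRing) +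
      (-q - (X - C x) * k₂) • mk W Y = 0 := by
    rw [← h3]
    simp only [sub_smul]
    abel
  obtain ⟨h6, h7⟩ := smul_basis_eq_zero h5
  have hq : q.eval x = 0 := by
    have := congrArg (eval x) h7
    simpa using this
  have hp : p.eval x = 0 := by
    have := congrArg (eval x) h6
    simpa [hq] using this
  -- so `f` vanishes at the negative of the point, while its only zero is the point itself
  have h' : W.Equation x (W.negY x y) := (equation_neg x y).2 h.1
  have hle : XYIdeal W x (C y) ^ n ≤ XYIdeal W x (C (W.negY x y)) := by
    rw [hf, Ideal.span_singleton_le_iff_mem, ← hpq, smul_basis_mem_XYIdeal h', hp, hq]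
    ring
  have hle2 := (XYIdeal_isMaximal h').isPrime.le_of_pow_le hle
  have hmem : YClass W (C y) ∈ XYIdeal W x (C (W.negY x y)) :=
    hle2 (Ideal.subset_span (by simp))
  have hY : YClass W (C y) = (-C y : F[X]) • (1 : W.CoordinateRing) + (1 : F[X]) • mk W Y := by
    simp only [YClass, smul, map_sub, mul_one, map_neg, map_one, one_mul]
    ring
  rw [hY, smul_basis_mem_XYIdeal h'] at hmem
  apply hy
  simp only [eval_neg, eval_C, eval_one, one_mul] at hmem
  linear_combination -hmem

/-- A function which vanishes to order `n` at a point not fixed by negation, and has a pole of order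
at most `n` at infinity, generates the `n`-th power of the ideal of the point. -/
theorem XYIdeal_pow_eq_span {x y : F} (h : W.Nonsingular x y) (hy : y ≠ W.negY x y)
    {c : PowerSeries F} (hc : W.polynomial.eval₂ (taylorSeries x) c = 0)
    (hcy : PowerSeries.constantCoeff c = y) {n : ℕ} (hn : n ≠ 0) {f : W.CoordinateRing}
    (hf0 : f ≠ 0) (hd : (Algebra.norm F[X] f).degree ≤ n)
    (hf : PowerSeries.X ^ n ∣ expand x c hc f) :
    XYIdeal W x (C y) ^ n = Ideal.span {f} := by
  have h' : W.Equation x (W.negY x y) := (equation_neg x y).2 h.1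
  obtain ⟨p, q, hfdef⟩ := exists_smul_basis_eq f
  have hconj := mul_conj_eq_norm (W := W) p q
  rw [hfdef] at hconj
  obtain ⟨g, hgdef⟩ : ∃ g, g =
      (p - q * (C W.a₁ * X + C W.a₃)) • (1 : W.CoordinateRing) + (-q) • mk W Y := ⟨_, rfl⟩
  rw [← hgdef] at hconj
  have hN0 : Algebra.norm F[X] f ≠ 0 :=
    have := Module.Finite.of_basis (CoordinateRing.basis W)
    Algebra.norm_ne_zero_iff.2 hf0
  obtain ⟨N, hN⟩ : ∃ N, N = Algebra.norm F[X] f := ⟨_, rfl⟩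
  rw [← hN] at hconj hN0 hd
  have hmkN : expand x c hc (mk W (C N)) = taylorSeries x N := by rw [expand_mk, eval₂_C]
  have hdvd : (X - C x) ^ n ∣ N := by
    rw [← X_pow_dvd_taylorSeries_iff, ← hmkN, ← hconj, map_mul]
    exact Dvd.dvd.mul_right hf _
  obtain ⟨r, hr⟩ := hdvd
  have hr0 : r ≠ 0 := by rintro rfl; exact hN0 (by rw [hr, mul_zero])
  obtain ⟨u, rfl, hu⟩ : ∃ u : F, r = C u ∧ u ≠ 0 := by
    have h1 : n + r.natDegree ≤ n := by
      have := natDegree_le_iff_degree_le.2 hd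
      rwa [hr, natDegree_mul (pow_ne_zero _ (X_sub_C_ne_zero x)) hr0, natDegree_pow,
        natDegree_X_sub_C, mul_one] at this
    have h2 := eq_C_of_natDegree_eq_zero (p := r) (by omega)
    exact ⟨_, h2, fun h3 => hr0 (by rw [h2, h3, C_0])⟩
  -- `f` vanishes at the point, but not at its negative: otherwise `X - x` divides `f`, and the
  -- quotient has too small a norm for the order to which it vanishes
  have hfx : p.eval x + q.eval x * y = 0 := by
    have h1 : PowerSeries.X ∣ expand x c hc f := (dvd_pow_self _ hn).trans hf
    rw [← hfdef, expand_smul_basis, PowerSeries.X_dvd_iff] at h1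
    simpa [taylorSeries_apply, hcy, ← coeff_zero_eq_eval_zero, taylor_coeff_zero] using h1
  have hYne : y - W.negY x y ≠ 0 := sub_ne_zero.2 hy
  have key : q.eval x ≠ 0 := by
    intro hq
    have hp : p.eval x = 0 := by simpa [hq] using hfx
    obtain ⟨p', hp'⟩ := dvd_iff_isRoot.2 hp
    obtain ⟨q', hq'⟩ := dvd_iff_isRoot.2 hq
    have hff : f = mk W (C (X - C x)) * (p' • 1 + q' • mk W Y) := by
      rw [← hfdef, hp', hq', mul_smul, mul_smul, ← smul_add, smul]
    obtain ⟨f', hf'⟩ : ∃ f', f' = p' • (1 : W.CoordinateRing) + q' • mk W Y := ⟨_, rfl⟩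
    rw [← hf'] at hff
    have hN' : N = (X - C x) ^ 2 * Algebra.norm F[X] f' := by
      rw [hN, hf', ← hfdef, norm_smul_basis, norm_smul_basis, hp', hq']
      ring
    have hconj' := mul_conj_eq_norm (W := W) p' q'
    rw [← hf'] at hconj'
    have h1 : PowerSeries.X ^ (n - 1) ∣ expand x c hc f' := by
      have h2 := hf
      rw [hff, map_mul, expand_mk, eval₂_C, taylorSeries_X_sub_C,
        show n = (n - 1) + 1 by omega, pow_succ'] at h2
      exact (mul_dvd_mul_iff_left PowerSeries.X_ne_zero).1 h2
    have h3 : (X - C x) ^ (n - 1) ∣ Algebra.norm F[X] f' := by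
      rw [← X_pow_dvd_taylorSeries_iff]
      have : taylorSeries x (Algebra.norm F[X] f') =
        expand x c hc (mk W (C (Algebra.norm F[X] f'))) := by rw [expand_mk, eval₂_C]
      rw [this, ← hconj', map_mul]
      exact Dvd.dvd.mul_right h1 _
    have h4 : (X - C x) ^ (n + 1) ∣ N := by
      rw [hN', show n + 1 = 2 + (n - 1) by omega, pow_add]
      exact mul_dvd_mul_left _ h3
    have h5 := natDegree_le_of_dvd h4 hN0
    rw [natDegree_pow, natDegree_X_sub_C] at h5
    have := natDegree_le_iff_degree_le.2 hd
    omega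
  have hfneg : f ∉ XYIdeal W x (C (W.negY x y)) := by
    rw [← hfdef, smul_basis_mem_XYIdeal h']
    intro h1
    apply mul_ne_zero key hYne
    linear_combination hfx - h1
  have hgpos : g ∉ XYIdeal W x (C y) := by
    rw [hgdef, smul_basis_mem_XYIdeal h.1]
    intro h1
    apply mul_ne_zero key hYne
    simp only [eval_sub, eval_mul, eval_add, eval_C, eval_X, eval_neg] at h1
    rw [negY]
    linear_combination hfx - h1
  have hfg : f * g = mk W (C ((X - C x) ^ n)) * mk W (C (C u)) := by
    rw [hconj, hr, map_mul, map_mul]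
  have hpow := XYIdeal_pow_mul_pow h n
  have hmem := Ideal.mem_of_mul_eq_span hpow hfg
  have hfm : f ∈ XYIdeal W x (C y) ^ n := mem_XYIdeal_pow_of_mul_mem h.1 hn hmem.1 hgpos
  have hgm : g ∈ XYIdeal W x (C (W.negY x y)) ^ n :=
    mem_XYIdeal_pow_of_mul_mem h' hn (mul_comm f g ▸ hmem.2) hfneg
  have hg0 : g ≠ 0 := fun h0 => hgpos (h0 ▸ zero_mem _)
  have hu1 : mk W (C (C u)) * mk W (C (C u⁻¹)) = 1 := by
    rw [← map_mul, ← C_mul, ← C_mul, mul_inv_cancel₀ hu, C_1, C_1, map_one]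
  exact Ideal.eq_span_of_mul_eq_span hpow hfm hgm hg0 hu1 hfg

end CoordinateRing

namespace Point

variable {F : Type*} [Field F] [DecidableEq F] {W : Affine F}

theorem nsmul_some_eq_zero_iff_exists_span {x y : F} (h : W.Nonsingular x y) (n : ℕ) :
    n • some x y h = 0 ↔ ∃ f, f ≠ 0 ∧ XYIdeal W x (C y) ^ n = Ideal.span {f} := by
  rw [← toClass_eq_zero, map_nsmul, toClass_some]
  change ClassGroup.mk W.FunctionField (XYIdeal' (W := W) h) ^ n = 1 ↔ _
  rw [← map_pow]
  apply ClassGroup.mk_eq_one_of_coe_ideal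
  rw [Units.val_pow_eq_pow_val, XYIdeal'_eq, FractionalIdeal.coeIdeal_pow]

/-- A point `(x, y)` not fixed by negation is killed by `n` exactly when some nonzero function with
a pole of order at most `n` at infinity vanishes to order `n` at the point. Here `c` is the expansion
of `Y` in powers of the local parameter `X - x`. -/
theorem nsmul_some_eq_zero_iff_exists_expand {x y : F} (h : W.Nonsingular x y)
    (hy : y ≠ W.negY x y) {c : PowerSeries F} (hc : W.polynomial.eval₂ (taylorSeries x) c = 0)
    (hcy : PowerSeries.constantCoeff c = y) {n : ℕ} (hn : n ≠ 0) :
    n • some x y h = 0 ↔ ∃ f : W.CoordinateRing, f ≠ 0 ∧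
      (Algebra.norm F[X] f).degree ≤ n ∧ PowerSeries.X ^ n ∣ expand x c hc f := by
  rw [nsmul_some_eq_zero_iff_exists_span]
  constructor
  · rintro ⟨f, hf0, hf⟩
    exact ⟨f, hf0, degree_norm_le_of_span_eq h hy hf,
      X_pow_dvd_expand hc hcy (hf ▸ Ideal.mem_span_singleton_self f)⟩
  · rintro ⟨f, hf0, hd, hf⟩
    exact ⟨f, hf0, XYIdeal_pow_eq_span h hy hc hcy hn hf0 hd hf⟩

end Point

end

end WeierstrassCurve.Affine

/-! ### Padé approximation and Hankel determinants -/

namespace PowerSeries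

theorem coeff_polynomial_mul {F : Type*} [CommSemiring F] {q : F[X]} {m : ℕ} (hq : q.degree < m)
    (c : PowerSeries F) {N : ℕ} (hN : m ≤ N + 1) :
    coeff N ((q : PowerSeries F) * c) =
      ∑ j ∈ Finset.range m, coeff (N + 1 - m + j) c * q.coeff (m - 1 - j) := by
  rw [coeff_mul, Finset.Nat.sum_antidiagonal_eq_sum_range_succ_mk, Nat.succ_eq_add_one]
  have h1 : ∑ j ∈ Finset.range m, coeff (N + 1 - m + (m - 1 - j)) c * q.coeff (m - 1 - (m - 1 - j))
      = ∑ j ∈ Finset.range m, coeff (N - j) c * q.coeff j := by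
    refine Finset.sum_congr rfl fun j hj => ?_
    have := Finset.mem_range.1 hj
    rw [show N + 1 - m + (m - 1 - j) = N - j by omega, show m - 1 - (m - 1 - j) = j by omega]
  rw [← Finset.sum_range_reflect (fun j => coeff (N + 1 - m + j) c * q.coeff (m - 1 - j)), h1,
    ← Finset.sum_subset (Finset.range_subset_range.2 hN)]
  · refine Finset.sum_congr rfl fun j _ => ?_
    rw [Polynomial.coeff_coe, mul_comm]
  · intro j _ hj
    rw [Polynomial.coeff_coe, coeff_eq_zero_of_degree_lt, zero_mul]
    refine hq.trans_le ?_
    simpa using hj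

/-- A power series `c` has a Padé approximant `-p / q` with `deg q < m` and `deg p < m + s` of
order exceeding the expected one by one exactly when the `m × m` Hankel determinant of `c` that
starts at index `s + 1` vanishes. -/
theorem exists_pade_iff_det_eq_zero {F : Type*} [Field F] (c : PowerSeries F) (s m : ℕ) :
    (∃ p q : F[X], ¬ (p = 0 ∧ q = 0) ∧ p.degree < (m + s : ℕ) ∧ q.degree < m ∧
      X ^ (2 * m + s) ∣ (p : PowerSeries F) + (q : PowerSeries F) * c) ↔
    (Matrix.of fun i j : Fin m => coeff (s + 1 + (i : ℕ) + (j : ℕ)) c).det = 0 := by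
  rw [← Matrix.exists_mulVec_eq_zero_iff]
  have hmul (q : F[X]) (hq : q.degree < m) (i : Fin m) :
      Matrix.mulVec (Matrix.of fun i j : Fin m => coeff (s + 1 + (i : ℕ) + (j : ℕ)) c)
        (fun j => q.coeff (m - 1 - j)) i = coeff (m + s + i) ((q : PowerSeries F) * c) := by
    rw [coeff_polynomial_mul hq c (by omega), Matrix.mulVec, dotProduct, Finset.sum_range]
    refine Finset.sum_congr rfl fun j _ => ?_
    rw [Matrix.of_apply, show m + s + i + 1 - m + j = s + 1 + (i : ℕ) + (j : ℕ) by omega]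
  constructor
  · rintro ⟨p, q, h0, hp, hq, hdvd⟩
    rw [X_pow_dvd_iff] at hdvd
    refine ⟨fun j => q.coeff (m - 1 - j), fun hv => h0 ?_, ?_⟩
    · have hq0 : q = 0 := by
        ext j
        by_cases hj : j < m
        · have := congrFun hv ⟨m - 1 - j, by omega⟩
          simp only [Pi.zero_apply] at this
          rwa [show m - 1 - (m - 1 - j) = j by omega] at this
        · rw [coeff_eq_zero_of_degree_lt (hq.trans_le (by exact_mod_cast not_lt.1 hj)), coeff_zero]
      refine ⟨?_, hq0⟩
      ext j
      by_cases hj : j < m + s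
      · simpa [hq0] using hdvd j (by omega)
      · rw [coeff_eq_zero_of_degree_lt (hp.trans_le (by exact_mod_cast not_lt.1 hj)), coeff_zero]
    · ext i
      have h1 := hdvd (m + s + i) (by omega)
      rw [map_add, Polynomial.coeff_coe, coeff_eq_zero_of_degree_lt
        (hp.trans_le (by exact_mod_cast Nat.le_add_right _ _)), zero_add] at h1
      rw [hmul q hq, h1, Pi.zero_apply]
  · rintro ⟨v, hv0, hv⟩
    obtain ⟨q, hq, hqv⟩ : ∃ q : F[X], q.degree < m ∧ (fun j : Fin m => q.coeff (m - 1 - j)) = v := by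
      refine ⟨∑ j : Fin m, Polynomial.C (v j.rev) * Polynomial.X ^ (j : ℕ), degree_sum_fin_lt _, ?_⟩
      ext j
      have := j.2
      rw [finsetSum_coeff, Finset.sum_eq_single j.rev]
      · simp [Fin.val_rev, show m - (j + 1) = m - 1 - j by omega]
      · intro k _ hk
        rw [Polynomial.coeff_C_mul_X_pow, if_neg]
        intro h
        apply hk
        ext
        rw [Fin.val_rev]
        omega
      · simp
    subst hqv
    refine ⟨-trunc (m + s) ((q : PowerSeries F) * c), q, fun h => hv0 ?_, ?_, hq, ?_⟩
    · ext j
      simp [h.2]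
    · rw [degree_neg]
      exact degree_trunc_lt _ _
    · rw [X_pow_dvd_iff]
      intro i hi
      rw [map_add, Polynomial.coeff_coe, coeff_neg, coeff_trunc]
      split_ifs with h
      · simp
      · have h1 := hmul q hq ⟨i - (m + s), by omega⟩
        rw [hv] at h1
        simp only [Pi.zero_apply] at h1
        rw [show m + s + (i - (m + s)) = i by omega] at h1
        rw [← h1, neg_zero, zero_add]

end PowerSeries

namespace WeierstrassCurve.Affine

open CoordinateRing
open scoped Polynomial.Bivariate

variable {F : Type*} [Field F] {W : Affine F}

/-- The pole of `p + q Y` at infinity has order at most `2 m + s`, in terms of degrees. -/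
theorem CoordinateRing.degree_norm_smul_basis_le_iff (p q : F[X]) {s : ℕ} (m : ℕ)
    (hs : s = 1 ∨ s = 2) :
    (Algebra.norm F[X] (p • (1 : W.CoordinateRing) + q • mk W Y)).degree ≤
      (2 * m + s : ℕ) ↔ p.degree < (m + s : ℕ) ∧ q.degree < m := by
  rw [degree_norm_smul_basis, max_le_iff]
  refine and_congr ?_ ?_
  · rcases eq_or_ne p 0 with rfl | hp
    · simp
    · rw [degree_eq_natDegree hp, two_nsmul]
      norm_cast
      omega
  · rcases eq_or_ne q 0 with rfl | hq
    · simp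
    · rw [degree_eq_natDegree hq, two_nsmul]
      norm_cast
      omega

/-- Cayley's criterion: a point `(x, y)` not fixed by negation is killed by `n ≥ 2` exactly when a
Hankel determinant of the expansion `c` of `Y` in powers of `X - x` vanishes. With `s = 1` this
concerns `n = 2 m + 1`, with `s = 2` it concerns `n = 2 m + 2`. -/
theorem nsmul_some_eq_zero_iff_det_eq_zero [DecidableEq F] {x y : F} (h : W.Nonsingular x y)
    (hy : y ≠ W.negY x y) {c : PowerSeries F} (hc : W.polynomial.eval₂ (taylorSeries x) c = 0)
    (hcy : PowerSeries.constantCoeff c = y) {s : ℕ} (m : ℕ) (hs : s = 1 ∨ s = 2) :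
    (2 * m + s) • Point.some x y h = 0 ↔
      (Matrix.of fun i j : Fin m => PowerSeries.coeff (s + 1 + (i : ℕ) + (j : ℕ)) c).det = 0 := by
  rw [Point.nsmul_some_eq_zero_iff_exists_expand h hy hc hcy (by omega),
    ← PowerSeries.exists_pade_iff_det_eq_zero]
  constructor
  · rintro ⟨f, hf0, hd, hf⟩
    obtain ⟨p, q, rfl⟩ := exists_smul_basis_eq f
    rw [degree_norm_smul_basis_le_iff _ _ m hs] at hd
    rw [expand_smul_basis] at hf
    refine ⟨taylor x p, taylor x q, fun h0 => hf0 ?_, by simpa using hd.1, by simpa using hd.2, hf⟩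
    rw [(taylor_eq_zero x p).1 h0.1, (taylor_eq_zero x q).1 h0.2, zero_smul, zero_smul, zero_add]
  · rintro ⟨p, q, h0, hp, hq, hdvd⟩
    have inv (r : F[X]) : taylor x (taylor (-x) r) = r := by
      rw [taylor_taylor, add_neg_cancel, taylor_zero]
    refine ⟨taylor (-x) p • (1 : W.CoordinateRing) + taylor (-x) q • CoordinateRing.mk W Y,
      fun hf => h0 ?_, ?_, ?_⟩
    · obtain ⟨h1, h2⟩ := smul_basis_eq_zero hf
      exact ⟨(taylor_eq_zero _ _).1 h1, (taylor_eq_zero _ _).1 h2⟩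
    · rw [degree_norm_smul_basis_le_iff _ _ m hs]
      exact ⟨by simpa using hp, by simpa using hq⟩
    · rw [expand_smul_basis, taylorSeries_apply, taylorSeries_apply, inv, inv]
      exact hdvd

end WeierstrassCurve.Affine

/-! ### The Taylor coefficients of the square root -/

namespace Biquadratic

noncomputable section

/-- The cubic polynomial `4x³ - D x + E`. -/
def cubicPoly (a : Matrix (Fin 3) (Fin 3) ℂ) : ℂ[X] := 4 * X ^ 3 - C (invD a) * X + C (invE a)

theorem cubicPoly_eval (a : Matrix (Fin 3) (Fin 3) ℂ) (x : ℂ) :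
    (cubicPoly a).eval x = 4 * x ^ 3 - invD a * x + invE a := by
  simp [cubicPoly]

theorem iteratedDeriv_polynomial_eval (p : ℂ[X]) (n : ℕ) (x : ℂ) :
    iteratedDeriv n (fun z => p.eval z) x = n.factorial * (taylor x p).coeff n := by
  have h (k : ℕ) : iteratedDeriv k (fun z => p.eval z) = fun z => (derivative^[k] p).eval z := by
    induction k with
    | zero => simp
    | succ k ih =>
      rw [iteratedDeriv_succ, ih, Function.iterate_succ_apply']
      ext z
      rw [Polynomial.deriv]
  rw [h, taylor_coeff, ← factorial_smul_hasseDeriv]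
  simp

/-- The power series with coefficients `C_j`. -/
def taylorPowerSeries (a : Matrix (Fin 3) (Fin 3) ℂ) : PowerSeries ℂ :=
  PowerSeries.mk (taylorCoeff a)

theorem taylorPowerSeries_sq (a : Matrix (Fin 3) (Fin 3) ℂ) (h : ptY a ≠ 0) :
    taylorPowerSeries a ^ 2 = ((taylor (ptX a) (cubicPoly a) : ℂ[X]) : PowerSeries ℂ) := by
  obtain ⟨han, -, hsq⟩ := sqrtBranch_spec a h
  ext n
  have hcd : ContDiffAt ℂ n (sqrtBranch a) (ptX a) := han.contDiffAt
  have h1 := iteratedDeriv_mul hcd hcd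
  have h2 : sqrtBranch a * sqrtBranch a = fun z => (cubicPoly a).eval z := by
    ext z
    rw [cubicPoly_eval, ← hsq, Pi.mul_apply, sq]
  have hn : (n.factorial : ℂ) ≠ 0 := by exact_mod_cast n.factorial_ne_zero
  rw [h2, iteratedDeriv_polynomial_eval] at h1
  rw [Polynomial.coeff_coe, ← mul_right_inj' hn, h1, sq, PowerSeries.coeff_mul,
    Finset.Nat.sum_antidiagonal_eq_sum_range_succ_mk, Finset.mul_sum]
  refine Finset.sum_congr rfl fun i hi => ?_
  have hi' : i ≤ n := Nat.lt_succ_iff.1 (Finset.mem_range.1 hi)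
  simp only [taylorPowerSeries, PowerSeries.coeff_mk, taylorCoeff]
  have e : (n.choose i : ℂ) * i.factorial * (n - i).factorial = n.factorial := by
    exact_mod_cast Nat.choose_mul_factorial_mul_factorial hi'
  have hi0 : (i.factorial : ℂ) ≠ 0 := by exact_mod_cast i.factorial_ne_zero
  have hni0 : ((n - i).factorial : ℂ) ≠ 0 := by exact_mod_cast (n - i).factorial_ne_zero
  rw [← e]
  field_simp

theorem taylorCoeff_zero (a : Matrix (Fin 3) (Fin 3) ℂ) (h : ptY a ≠ 0) :
    taylorCoeff a 0 = ptY a := by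
  simp [taylorCoeff, (sqrtBranch_spec a h).2.1]

/-! ### Rationality of the Taylor coefficients -/

/-- A complex function of a matrix is rational on the smooth locus with nonzero determinant if it is
there a quotient of polynomials in the entries with rational coefficients, whose denominator has no
zero on this locus. -/
def IsRationalInEntries (f : Matrix (Fin 3) (Fin 3) ℂ → ℂ) : Prop :=
  ∃ p q : MvPolynomial (Fin 3 × Fin 3) ℚ,
    ∀ a : Matrix (Fin 3) (Fin 3) ℂ, IsSmoothCubic a → a.det ≠ 0 →
      MvPolynomial.aeval (fun ij : Fin 3 × Fin 3 => a ij.1 ij.2) q ≠ 0 ∧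
      f a = MvPolynomial.aeval (fun ij : Fin 3 × Fin 3 => a ij.1 ij.2) p /
        MvPolynomial.aeval (fun ij : Fin 3 × Fin 3 => a ij.1 ij.2) q

namespace IsRationalInEntries

variable {f g : Matrix (Fin 3) (Fin 3) ℂ → ℂ}

theorem entry (i j : Fin 3) : IsRationalInEntries fun a => a i j :=
  ⟨MvPolynomial.X (i, j), 1, fun a _ _ => by simp⟩

theorem const (r : ℚ) : IsRationalInEntries fun _ => (r : ℂ) :=
  ⟨MvPolynomial.C r, 1, fun a _ _ => by simp⟩

theorem ofNat (n : ℕ) [n.AtLeastTwo] : IsRationalInEntries fun _ => (ofNat(n) : ℂ) := by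
  simpa using const (OfNat.ofNat n)

theorem add (hf : IsRationalInEntries f) (hg : IsRationalInEntries g) :
    IsRationalInEntries fun a => f a + g a := by
  obtain ⟨p, q, h⟩ := hf
  obtain ⟨p', q', h'⟩ := hg
  refine ⟨p * q' + q * p', q * q', fun a hs hd => ?_⟩
  obtain ⟨h1, h2⟩ := h a hs hd
  obtain ⟨h3, h4⟩ := h' a hs hd
  beta_reduce
  rw [h2, h4]
  simp only [map_mul, map_add]
  exact ⟨mul_ne_zero h1 h3, div_add_div _ _ h1 h3⟩

theorem mul (hf : IsRationalInEntries f) (hg : IsRationalInEntries g) :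
    IsRationalInEntries fun a => f a * g a := by
  obtain ⟨p, q, h⟩ := hf
  obtain ⟨p', q', h'⟩ := hg
  refine ⟨p * p', q * q', fun a hs hd => ?_⟩
  obtain ⟨h1, h2⟩ := h a hs hd
  obtain ⟨h3, h4⟩ := h' a hs hd
  beta_reduce
  rw [h2, h4]
  simp only [map_mul]
  exact ⟨mul_ne_zero h1 h3, div_mul_div_comm _ _ _ _⟩

theorem neg (hf : IsRationalInEntries f) : IsRationalInEntries fun a => -f a := by
  simpa using (const (-1)).mul hf

theorem sub (hf : IsRationalInEntries f) (hg : IsRationalInEntries g) :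
    IsRationalInEntries fun a => f a - g a := by
  simpa [sub_eq_add_neg] using hf.add hg.neg

theorem pow (hf : IsRationalInEntries f) (n : ℕ) : IsRationalInEntries fun a => f a ^ n := by
  induction n with
  | zero => simpa using const 1
  | succ n ih => simpa [pow_succ] using ih.mul hf

theorem inv (hf : IsRationalInEntries f) (h0 : ∀ a, IsSmoothCubic a → a.det ≠ 0 → f a ≠ 0) :
    IsRationalInEntries fun a => (f a)⁻¹ := by
  obtain ⟨p, q, h⟩ := hf
  refine ⟨q, p, fun a hs hd => ?_⟩
  obtain ⟨h1, h2⟩ := h a hs hd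
  have := h0 a hs hd
  beta_reduce
  rw [h2] at this ⊢
  exact ⟨fun h => this (by rw [h, zero_div]), inv_div _ _⟩

theorem div (hf : IsRationalInEntries f) (hg : IsRationalInEntries g)
    (h0 : ∀ a, IsSmoothCubic a → a.det ≠ 0 → g a ≠ 0) :
    IsRationalInEntries fun a => f a / g a := by
  simpa [div_eq_mul_inv] using hf.mul (hg.inv h0)

theorem sum {ι : Type*} (s : Finset ι) {f : ι → Matrix (Fin 3) (Fin 3) ℂ → ℂ}
    (hf : ∀ i ∈ s, IsRationalInEntries (f i)) : IsRationalInEntries fun a => ∑ i ∈ s, f i a := by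
  classical
  induction s using Finset.induction_on with
  | empty => simpa using const 0
  | insert i s hi ih =>
    simp only [Finset.sum_insert hi]
    exact (hf i (Finset.mem_insert_self i s)).add
      (ih fun j hj => hf j (Finset.mem_insert_of_mem hj))

theorem congr (hf : IsRationalInEntries f)
    (h : ∀ a, IsSmoothCubic a → a.det ≠ 0 → g a = f a) : IsRationalInEntries g := by
  obtain ⟨p, q, hpq⟩ := hf
  refine ⟨p, q, fun a hs hd => ?_⟩
  rw [h a hs hd]
  exact hpq a hs hd

theorem ptX : IsRationalInEntries ptX := by
  unfold Biquadratic.ptX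
  refine div ?_ (ofNat 12) (fun _ _ _ => by norm_num)
  refine add (add (sub (sub ?_ ?_) ?_) ?_) ?_
  · exact (entry _ _).pow 2
  all_goals exact ((ofNat _).mul (entry _ _)).mul (entry _ _)

theorem ptY : IsRationalInEntries ptY := by
  have h (i j k l m n : Fin 3) :
      IsRationalInEntries fun a => a i j * a k l * a m n :=
    ((entry _ _).mul (entry _ _)).mul (entry _ _)
  refine congr (((((h 0 0 1 1 2 2).sub (h 0 0 1 2 2 1)).sub (h 0 1 1 0 2 2)).add
    (h 0 1 1 2 2 0)).add (h 0 2 1 0 2 1) |>.sub (h 0 2 1 1 2 0)) fun a _ _ => ?_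
  rw [Biquadratic.ptY, Matrix.det_fin_three]

theorem discX_coeff (k : ℕ) : IsRationalInEntries fun a => (discX a).coeff k := by
  have e := entry
  have m (i j k l : Fin 3) : IsRationalInEntries fun a => a i j * a k l := (e i j).mul (e k l)
  have h0 := ((e 1 0).pow 2).sub (((ofNat 4).mul (e 2 0)).mul (e 0 0))
  have h1 := (((ofNat 2).mul (e 1 0)).mul (e 1 1)).sub
    ((ofNat 4).mul ((m 2 1 0 0).add (m 2 0 0 1)))
  have h2 := (((e 1 1).pow 2).add (((ofNat 2).mul (e 1 2)).mul (e 1 0))).sub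
    ((ofNat 4).mul (((m 2 2 0 0).add (m 2 1 0 1)).add (m 2 0 0 2)))
  have h3 := (((ofNat 2).mul (e 1 1)).mul (e 1 2)).sub
    ((ofNat 4).mul ((m 2 2 0 1).add (m 2 1 0 2)))
  have h4 := ((e 1 2).pow 2).sub (((ofNat 4).mul (e 2 2)).mul (e 0 2))
  match k with
  | 0 => exact h0.congr fun a _ _ => (Biquadratic.discX_coeff a).1
  | 1 => exact h1.congr fun a _ _ => (Biquadratic.discX_coeff a).2.1
  | 2 => exact h2.congr fun a _ _ => (Biquadratic.discX_coeff a).2.2.1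
  | 3 => exact h3.congr fun a _ _ => (Biquadratic.discX_coeff a).2.2.2.1
  | 4 => exact h4.congr fun a _ _ => (Biquadratic.discX_coeff a).2.2.2.2
  | k + 5 =>
    refine (const 0).congr fun a _ _ => ?_
    rw [discX_eq]
    simp only [coeff_add, coeff_C_mul, coeff_X_pow, coeff_X, coeff_C]
    repeat rw [if_neg (by omega)]
    simp

theorem invD : IsRationalInEntries invD := by
  unfold Biquadratic.invD eisensteinD
  have d (k n : ℕ) [n.AtLeastTwo] : IsRationalInEntries fun a => (discX a).coeff k / ofNat(n) :=
    (discX_coeff k).div (ofNat n) fun _ _ _ => NeZero.ne _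
  exact (((discX_coeff 0).mul (discX_coeff 4)).add ((ofNat 3).mul ((d 2 6).pow 2))).sub
    (((ofNat 4).mul (d 1 4)).mul (d 3 4))

theorem invE : IsRationalInEntries invE := by
  unfold Biquadratic.invE eisensteinE
  have d (k n : ℕ) [n.AtLeastTwo] : IsRationalInEntries fun a => (discX a).coeff k / ofNat(n) :=
    (discX_coeff k).div (ofNat n) fun _ _ _ => NeZero.ne _
  exact (((((discX_coeff 0).mul ((d 3 4).pow 2)).add (((d 1 4).pow 2).mul (discX_coeff 4))).sub
    (((discX_coeff 0).mul (d 2 6)).mul (discX_coeff 4))).sub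
    ((((ofNat 2).mul (d 1 4)).mul (d 2 6)).mul (d 3 4))).add ((d 2 6).pow 3)

theorem taylor_cubicPoly_coeff (k : ℕ) :
    IsRationalInEntries fun a => (taylor (Biquadratic.ptX a) (cubicPoly a)).coeff k := by
  have h (a) : taylor (Biquadratic.ptX a) (cubicPoly a) = C 4 * X ^ 3
      + C (12 * Biquadratic.ptX a) * X ^ 2
      + C (12 * Biquadratic.ptX a ^ 2 - Biquadratic.invD a) * X
      + C (4 * Biquadratic.ptX a ^ 3 - Biquadratic.invD a * Biquadratic.ptX a
        + Biquadratic.invE a) := by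
    simp only [cubicPoly, map_add, map_sub, taylor_mul, taylor_pow, taylor_X, taylor_C, map_mul,
      map_pow, map_ofNat]
    have : taylor (Biquadratic.ptX a) (4 : ℂ[X]) = 4 := taylor_C _ (4 : ℂ)
    rw [this]
    ring
  simp only [h]
  match k with
  | 0 =>
    refine ((((ofNat 4).mul (ptX.pow 3)).sub (invD.mul ptX)).add invE).congr fun a _ _ => ?_
    simp only [coeff_add, coeff_C_mul, coeff_X_pow, coeff_X, coeff_C]
    norm_num
  | 1 =>
    refine (((ofNat 12).mul (ptX.pow 2)).sub invD).congr fun a _ _ => ?_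
    simp only [coeff_add, coeff_C_mul, coeff_X_pow, coeff_X, coeff_C]
    norm_num
  | 2 =>
    refine ((ofNat 12).mul ptX).congr fun a _ _ => ?_
    simp only [coeff_add, coeff_C_mul, coeff_X_pow, coeff_X, coeff_C]
    norm_num
  | 3 =>
    refine (ofNat 4).congr fun a _ _ => ?_
    simp only [coeff_add, coeff_C_mul, coeff_X_pow, coeff_X, coeff_C]
    norm_num
  | k + 4 =>
    refine (const 0).congr fun a _ _ => ?_
    simp only [coeff_add, coeff_C_mul, coeff_X_pow, coeff_X, coeff_C]
    repeat rw [if_neg (by omega)]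
    simp

/-- Comparing coefficients in the square of the series gives a recursion for the `C_j` with
denominator `2 Y`. -/
theorem taylorCoeff (j : ℕ) : IsRationalInEntries fun a => taylorCoeff a j := by
  induction j using Nat.strong_induction_on with
  | _ j ih =>
    rcases j with _ | j
    · exact ptY.congr fun a _ hd => taylorCoeff_zero a hd
    · have h := ((taylor_cubicPoly_coeff (j + 1)).sub (sum (Finset.range j)
        (f := fun i a => Biquadratic.taylorCoeff a (i + 1) * Biquadratic.taylorCoeff a (j - i))
        fun i hi => (ih (i + 1) (by simpa using hi)).mul (ih (j - i) (by omega)))).div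
          ((ofNat 2).mul ptY) fun a _ hd => mul_ne_zero two_ne_zero hd
      refine h.congr fun a _ hd => ?_
      have hY : Biquadratic.ptY a ≠ 0 := hd
      have h1 := congrArg (PowerSeries.coeff (j + 1)) (taylorPowerSeries_sq a hY)
      rw [Polynomial.coeff_coe, sq, PowerSeries.coeff_mul,
        Finset.Nat.sum_antidiagonal_eq_sum_range_succ_mk, Finset.sum_range_succ,
        Finset.sum_range_succ'] at h1
      simp only [taylorPowerSeries, PowerSeries.coeff_mk, tsub_zero, tsub_self,
        taylorCoeff_zero a hY, Nat.add_sub_add_right] at h1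
      rw [eq_div_iff (mul_ne_zero two_ne_zero hY), ← h1]
      ring

end IsRationalInEntries

end

end Biquadratic

/-! ### The order of the translation -/

namespace Biquadratic

noncomputable section

open WeierstrassCurve.Affine

theorem ptX_ptY_nonsingular (a : Matrix (Fin 3) (Fin 3) ℂ) (hs : IsSmoothCubic a) :
    (weierstrass a).Nonsingular (ptX a) (ptY a / 2) :=
  weierstrass_nonsingular a hs _ _ <| (weierstrass_equation a _ _).2 <| by
    rw [mul_div_cancel₀ _ two_ne_zero, ptY_sq]

/-- The point of the Weierstrass model that corresponds to `[1 : X : Y]`. -/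
def weierstrassPoint (a : Matrix (Fin 3) (Fin 3) ℂ) (hs : IsSmoothCubic a) :
    (weierstrass a).Point :=
  .some _ _ (ptX_ptY_nonsingular a hs)

theorem toCubic_weierstrassPoint (a : Matrix (Fin 3) (Fin 3) ℂ) (hs : IsSmoothCubic a) :
    toCubic a (weierstrassPoint a hs) = translationPoint a := by
  simp only [weierstrassPoint, toCubic, translationPoint, mul_div_cancel₀ _ (two_ne_zero' ℂ)]

theorem translation_pow_eq_one_iff (a : Matrix (Fin 3) (Fin 3) ℂ) (hs : IsSmoothCubic a) (n : ℕ) :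
    translation a hs ^ n = 1 ↔ n • weierstrassPoint a hs = 0 := by
  let := cubicAddCommGroup a hs
  let e : cubic a ≃+ (weierstrass a).Point :=
    (Equiv.ofBijective (toCubic a) (toCubic_bijective a hs)).symm.addEquiv
  have he : e (translationPoint a) = weierstrassPoint a hs := by
    rw [← toCubic_weierstrassPoint a hs]
    exact Equiv.ofBijective_symm_apply_apply (toCubic a) (toCubic_bijective a hs) _
  have h1 : translation a hs ^ n = Equiv.addRight (n • translationPoint a) := by
    induction n with
    | zero =>
      ext x
      simp
    | succ n ih =>
      rw [pow_succ, ih]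
      refine Equiv.ext fun x => ?_
      change (x + translationPoint a) + n • translationPoint a = x + (n + 1) • translationPoint a
      rw [succ_nsmul', add_assoc]
  rw [h1, ← he, ← map_nsmul, EmbeddingLike.map_eq_zero_iff]
  constructor
  · intro h
    simpa using DFunLike.congr_fun h 0
  · intro h
    rw [h]
    ext x
    simp

theorem eval₂_weierstrass_polynomial (a : Matrix (Fin 3) (Fin 3) ℂ) (h : ptY a ≠ 0) :
    (weierstrass a).polynomial.eval₂ (CoordinateRing.taylorSeries (ptX a))
      (PowerSeries.C (2⁻¹ : ℂ) * taylorPowerSeries a) = 0 := by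
  have h1 : (X ^ 3 + C (0 : ℂ) * X ^ 2 + C (-invD a / 4) * X + C (invE a / 4) : ℂ[X]) =
      C (4⁻¹ : ℂ) * cubicPoly a := by
    have : (C (4⁻¹ : ℂ) : ℂ[X]) * 4 = 1 := by
      rw [← C_ofNat, ← C_mul]
      norm_num
    simp only [cubicPoly, mul_add, mul_sub, ← mul_assoc, this, div_eq_inv_mul, C_mul, C_neg, C_0]
    ring
  have h2 : CoordinateRing.taylorSeries (ptX a) (C (4⁻¹ : ℂ)) = PowerSeries.C (4⁻¹ : ℂ) := by
    rw [CoordinateRing.taylorSeries_apply, taylor_C, Polynomial.coe_C]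
  rw [WeierstrassCurve.Affine.polynomial]
  simp only [weierstrass]
  rw [h1, eval₂_sub, eval₂_C, map_mul, h2, CoordinateRing.taylorSeries_apply,
    ← taylorPowerSeries_sq a h]
  simp only [map_zero, zero_mul, add_zero, eval₂_pow, eval₂_X]
  rw [mul_pow, ← map_pow, sub_eq_zero]
  norm_num

theorem nsmul_weierstrassPoint_eq_zero_iff (a : Matrix (Fin 3) (Fin 3) ℂ) (hs : IsSmoothCubic a)
    (hd : a.det ≠ 0) (m s : ℕ) (hsm : s = 1 ∨ s = 2) :
    (2 * m + s) • weierstrassPoint a hs = 0 ↔ hankelDet a (s + 1) m = 0 := by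
  have hY : ptY a ≠ 0 := hd
  have hneg : ptY a / 2 ≠ (weierstrass a).negY (ptX a) (ptY a / 2) := by
    simp only [negY, weierstrass]
    intro h
    apply hY
    linear_combination h
  rw [weierstrassPoint, nsmul_some_eq_zero_iff_det_eq_zero (ptX_ptY_nonsingular a hs) hneg
    (eval₂_weierstrass_polynomial a hY) (by
      simp [taylorPowerSeries, ← PowerSeries.coeff_zero_eq_constantCoeff_apply,
        taylorCoeff_zero a hY, div_eq_inv_mul]) m hsm]
  have h1 : (Matrix.of fun i j : Fin m => PowerSeries.coeff (s + 1 + (i : ℕ) + (j : ℕ))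
      (PowerSeries.C (2⁻¹ : ℂ) * taylorPowerSeries a)) =
      (2⁻¹ : ℂ) • Matrix.of fun i j : Fin m => taylorCoeff a (s + 1 + (i : ℕ) + (j : ℕ)) := by
    ext i j
    simp [taylorPowerSeries]
  rw [h1, Matrix.det_smul, hankelDet, mul_eq_zero, or_iff_right (pow_ne_zero _ (by norm_num))]

theorem two_nsmul_weierstrassPoint_eq_zero_iff (a : Matrix (Fin 3) (Fin 3) ℂ)
    (hs : IsSmoothCubic a) : 2 • weierstrassPoint a hs = 0 ↔ a.det = 0 := by
  rw [two_nsmul, add_eq_zero_iff_eq_neg, weierstrassPoint, Point.neg_some, Point.some.injEq]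
  simp only [negY, weierstrass, true_and]
  change ptY a / 2 = _ ↔ ptY a = 0
  constructor <;> intro h
  · linear_combination h
  · rw [h]
    ring

theorem translation_ne_one (a : Matrix (Fin 3) (Fin 3) ℂ) (hs : IsSmoothCubic a) :
    translation a hs ≠ 1 := by
  intro h
  have := (translation_pow_eq_one_iff a hs 1).1 (by rw [pow_one, h])
  rw [one_nsmul] at this
  exact Point.some_ne_zero _ this

theorem orderOf_translation_eq_two_iff (a : Matrix (Fin 3) (Fin 3) ℂ) (hs : IsSmoothCubic a) :
    orderOf (translation a hs) = 2 ↔ a.det = 0 := by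
  rw [← two_nsmul_weierstrassPoint_eq_zero_iff a hs, ← translation_pow_eq_one_iff]
  constructor
  · intro h
    rw [← h, pow_orderOf_eq_one]
  · intro h
    exact orderOf_eq_prime h (translation_ne_one a hs)

theorem translation_pow_odd_eq_one_iff (a : Matrix (Fin 3) (Fin 3) ℂ) (hs : IsSmoothCubic a)
    (hd : a.det ≠ 0) (k : ℕ) :
    translation a hs ^ (2 * k + 1) = 1 ↔ hankelDet a 2 k = 0 := by
  rw [translation_pow_eq_one_iff, nsmul_weierstrassPoint_eq_zero_iff a hs hd k 1 (Or.inl rfl)]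

theorem translation_pow_even_eq_one_iff (a : Matrix (Fin 3) (Fin 3) ℂ) (hs : IsSmoothCubic a)
    (hd : a.det ≠ 0) {k : ℕ} (hk : 1 ≤ k) :
    translation a hs ^ (2 * k) = 1 ↔ hankelDet a 3 (k - 1) = 0 := by
  rw [translation_pow_eq_one_iff,
    ← nsmul_weierstrassPoint_eq_zero_iff a hs hd (k - 1) 2 (Or.inr rfl),
    show 2 * (k - 1) + 2 = 2 * k by omega]

/-- Away from `det = 0`, the condition of index `n ≥ 2` says that the `n`-th iterate of the
translation is the identity. -/
theorem cayleyCondition_iff (a : Matrix (Fin 3) (Fin 3) ℂ) (hs : IsSmoothCubic a)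
    (hd : a.det ≠ 0) {n : ℕ} (hn : 2 ≤ n) :
    CayleyCondition a n ↔ translation a hs ^ n = 1 := by
  constructor
  · rintro (⟨-, h⟩ | ⟨k, -, rfl, -, h⟩ | ⟨k, hk, rfl, -, h⟩)
    · exact absurd h hd
    · exact (translation_pow_odd_eq_one_iff a hs hd k).2 h
    · exact (translation_pow_even_eq_one_iff a hs hd (by omega)).2 h
  · intro h
    rcases Nat.even_or_odd' n with ⟨k, rfl | rfl⟩
    · rcases (show k = 1 ∨ 2 ≤ k by omega) with rfl | hk
      · rw [translation_pow_eq_one_iff, mul_one, two_nsmul_weierstrassPoint_eq_zero_iff] at h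
        exact absurd h hd
      · exact Or.inr (Or.inr ⟨k, hk, rfl, hd,
          (translation_pow_even_eq_one_iff a hs hd (by omega)).1 h⟩)
    · exact Or.inr (Or.inl ⟨k, by omega, rfl, hd, (translation_pow_odd_eq_one_iff a hs hd k).1 h⟩)

theorem not_cayleyCondition_one (a : Matrix (Fin 3) (Fin 3) ℂ) : ¬ CayleyCondition a 1 := by
  rintro (⟨h, -⟩ | ⟨k, hk, h, -⟩ | ⟨k, hk, h, -⟩) <;> omega

theorem cayleyCondition_iff_eq_two (a : Matrix (Fin 3) (Fin 3) ℂ) (hd : a.det = 0) (n : ℕ) :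
    CayleyCondition a n ↔ n = 2 := by
  constructor
  · rintro (⟨h, -⟩ | ⟨k, -, -, h, -⟩ | ⟨k, -, -, h, -⟩)
    · exact h
    · exact absurd hd h
    · exact absurd hd h
  · exact fun h => Or.inl ⟨h, hd⟩

theorem orderOf_translation_eq_iff (a : Matrix (Fin 3) (Fin 3) ℂ) (hs : IsSmoothCubic a) {n : ℕ}
    (hn : 1 ≤ n) : orderOf (translation a hs) = n ↔
      CayleyCondition a n ∧ ∀ m : ℕ, m ∣ n → m < n → ¬ CayleyCondition a m := by
  have h1 : orderOf (translation a hs) ≠ 1 := fun h =>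
    translation_ne_one a hs (orderOf_eq_one_iff.1 h)
  by_cases hd : a.det = 0
  · have h2 := (orderOf_translation_eq_two_iff a hs).2 hd
    simp only [cayleyCondition_iff_eq_two a hd, h2]
    constructor
    · rintro rfl
      exact ⟨rfl, fun m _ hm => hm.ne⟩
    · exact fun h => h.1.symm
  rcases (show n = 1 ∨ 2 ≤ n by omega) with rfl | hn2
  · exact iff_of_false h1 fun h => not_cayleyCondition_one a h.1
  rw [cayleyCondition_iff a hs hd hn2]
  constructor
  · rintro rfl
    refine ⟨pow_orderOf_eq_one _, fun m hm hlt hc => ?_⟩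
    have hm0 : m ≠ 0 := by
      rintro rfl
      have := Nat.eq_zero_of_zero_dvd hm
      omega
    have hm1 : m ≠ 1 := by
      rintro rfl
      exact not_cayleyCondition_one a hc
    rw [cayleyCondition_iff a hs hd (by omega)] at hc
    exact absurd (orderOf_le_of_pow_eq_one (by omega) hc) (by omega)
  · rintro ⟨h, hmin⟩
    have hdvd := orderOf_dvd_of_pow_eq_one h
    by_contra hne
    have hpos : 0 < orderOf (translation a hs) := Nat.pos_of_dvd_of_pos hdvd hn
    have hlt := lt_of_le_of_ne (Nat.le_of_dvd hn hdvd) hne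
    refine hmin _ hdvd hlt ?_
    rw [cayleyCondition_iff a hs hd (by omega)]
    exact pow_orderOf_eq_one _

end

end Biquadratic

/-! ### Points of the projective line and the switches -/

namespace Biquadratic

noncomputable section

/-- The point `[1 : x]` of the projective line. -/
def finPt (x : ℂ) : ℙ ℂ (Fin 2 → ℂ) :=
  Projectivization.mk ℂ ![1, x] fun h => one_ne_zero (congrFun h 0)

/-- The point `[0 : 1]` of the projective line. -/
def infPt : ℙ ℂ (Fin 2 → ℂ) :=
  Projectivization.mk ℂ ![0, 1] fun h => one_ne_zero (congrFun h 1)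

theorem finPt_ne_infPt (x : ℂ) : finPt x ≠ infPt := by
  intro h
  rw [finPt, infPt, Projectivization.mk_eq_mk_iff'] at h
  obtain ⟨u, hu⟩ := h
  have h0 := congrFun hu 0
  simp at h0

theorem eq_infPt_or_eq_finPt (p : ℙ ℂ (Fin 2 → ℂ)) : p = infPt ∨ ∃ x, p = finPt x := by
  induction p with
  | h v hv =>
    by_cases h0 : v 0 = 0
    · have h1 : v 1 ≠ 0 := fun h1 => hv (by ext i; fin_cases i <;> simp [h0, h1])
      left
      rw [infPt, Projectivization.mk_eq_mk_iff']
      exact ⟨v 1, by ext i; fin_cases i <;> simp [h0]⟩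
    · right
      refine ⟨v 1 / v 0, ?_⟩
      rw [finPt, Projectivization.mk_eq_mk_iff']
      refine ⟨v 0, ?_⟩
      ext i
      fin_cases i
      · simp
      · simp
        field_simp

theorem biform_smul (a : Matrix (Fin 3) (Fin 3) ℂ) (s t : ℂ) (u v : Fin 2 → ℂ) :
    biform a (s • u) (t • v) = s ^ 2 * t ^ 2 * biform a u v := by
  simp only [biform, Fin.sum_univ_three, Pi.smul_apply, smul_eq_mul, Fin.coe_ofNat_eq_mod]
  norm_num
  ring

theorem biform_eq (a : Matrix (Fin 3) (Fin 3) ℂ) (u v : Fin 2 → ℂ) : biform a u v =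
    (a 2 2 * v 1 ^ 2 + a 2 1 * v 1 * v 0 + a 2 0 * v 0 ^ 2) * u 1 ^ 2
    + (a 1 2 * v 1 ^ 2 + a 1 1 * v 1 * v 0 + a 1 0 * v 0 ^ 2) * u 1 * u 0
    + (a 0 2 * v 1 ^ 2 + a 0 1 * v 1 * v 0 + a 0 0 * v 0 ^ 2) * u 0 ^ 2 := by
  simp only [biform, Fin.sum_univ_three, Fin.coe_ofNat_eq_mod]
  norm_num
  ring

theorem mk_mem_curve (a : Matrix (Fin 3) (Fin 3) ℂ) {u v : Fin 2 → ℂ} (hu : u ≠ 0) (hv : v ≠ 0) :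
    (Projectivization.mk ℂ u hu, Projectivization.mk ℂ v hv) ∈ curve a ↔ biform a u v = 0 := by
  obtain ⟨s, hs⟩ := Projectivization.exists_smul_eq_mk_rep ℂ u hu
  obtain ⟨t, ht⟩ := Projectivization.exists_smul_eq_mk_rep ℂ v hv
  change biform a _ _ = 0 ↔ _
  rw [← hs, ← ht]
  change biform a ((s : ℂ) • u) ((t : ℂ) • v) = 0 ↔ _
  rw [biform_smul, mul_eq_zero, or_iff_right]
  exact mul_ne_zero (pow_ne_zero 2 s.ne_zero) (pow_ne_zero 2 t.ne_zero)

/-- The two roots of a binary form can be computed with arbitrary representatives. -/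
theorem hasRootPair_mk {F : (Fin 2 → ℂ) → ℂ} {u w : Fin 2 → ℂ} (hu : u ≠ 0) (hw : w ≠ 0) {c : ℂ}
    (hc : c ≠ 0) (hF : ∀ z, F z = c * (u 0 * z 1 - u 1 * z 0) * (w 0 * z 1 - w 1 * z 0)) :
    HasRootPair F (Projectivization.mk ℂ u hu) (Projectivization.mk ℂ w hw) := by
  obtain ⟨s, hs⟩ := Projectivization.exists_smul_eq_mk_rep ℂ u hu
  obtain ⟨t, ht⟩ := Projectivization.exists_smul_eq_mk_rep ℂ w hw
  have hs0 : (s : ℂ) ≠ 0 := s.ne_zero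
  have ht0 : (t : ℂ) ≠ 0 := t.ne_zero
  refine ⟨c / (s * t), div_ne_zero hc (mul_ne_zero hs0 ht0), fun z => ?_⟩
  rw [← hs, ← ht, hF]
  change _ = c / (s * t) * ((s * u 0) * z 1 - (s * u 1) * z 0) *
    ((t * w 0) * z 1 - (t * w 1) * z 0)
  field_simp

theorem HasRootPair.const_mul {F : (Fin 2 → ℂ) → ℂ} {p q : ℙ ℂ (Fin 2 → ℂ)} (h : HasRootPair F p q)
    {k : ℂ} (hk : k ≠ 0) : HasRootPair (fun z => k * F z) p q := by
  obtain ⟨c, hc, h⟩ := h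
  exact ⟨k * c, mul_ne_zero hk hc, fun z => by beta_reduce; rw [h]; ring⟩

theorem horizontalSwitch_eq {a : Matrix (Fin 3) (Fin 3) ℂ} {P : curve a} {q : ℙ ℂ (Fin 2 → ℂ)}
    (h : HasRootPair (fun z => biform a z P.1.2.rep) P.1.1 q) :
    (horizontalSwitch a P).1 = (q, P.1.2) := by
  have hex : ∃ q, HasRootPair (fun z => biform a z P.1.2.rep) P.1.1 q := ⟨q, h⟩
  rw [horizontalSwitch, dif_pos hex]
  exact Prod.ext (hex.choose_spec.unique h) rfl

theorem verticalSwitch_eq {a : Matrix (Fin 3) (Fin 3) ℂ} {P : curve a} {q : ℙ ℂ (Fin 2 → ℂ)}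
    (h : HasRootPair (fun z => biform a P.1.1.rep z) P.1.2 q) :
    (verticalSwitch a P).1 = (P.1.1, q) := by
  have hex : ∃ q, HasRootPair (fun z => biform a P.1.1.rep z) P.1.2 q := ⟨q, h⟩
  rw [verticalSwitch, dif_pos hex]
  exact Prod.ext rfl (hex.choose_spec.unique h)

theorem hasRootPair_biform_left (a : Matrix (Fin 3) (Fin 3) ℂ) {v : Fin 2 → ℂ} (hv : v ≠ 0)
    {p q : ℙ ℂ (Fin 2 → ℂ)} : HasRootPair (fun z => biform a z (Projectivization.mk ℂ v hv).rep) p q ↔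
      HasRootPair (fun z => biform a z v) p q := by
  obtain ⟨t, ht⟩ := Projectivization.exists_smul_eq_mk_rep ℂ v hv
  have ht0 : (t : ℂ) ≠ 0 := t.ne_zero
  have h1 (z) : biform a z (Projectivization.mk ℂ v hv).rep = t ^ 2 * biform a z v := by
    rw [← ht]
    change biform a z ((t : ℂ) • v) = _
    rw [← one_smul ℂ z, biform_smul, one_pow, one_mul]
    simp
  simp only [h1]
  refine ⟨fun h => ?_, fun h => h.const_mul (pow_ne_zero 2 ht0)⟩
  have h2 := h.const_mul (inv_ne_zero (pow_ne_zero 2 ht0))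
  simpa [← mul_assoc, inv_mul_cancel₀ (pow_ne_zero 2 ht0)] using h2

theorem hasRootPair_biform_right (a : Matrix (Fin 3) (Fin 3) ℂ) {u : Fin 2 → ℂ} (hu : u ≠ 0)
    {p q : ℙ ℂ (Fin 2 → ℂ)} : HasRootPair (fun z => biform a (Projectivization.mk ℂ u hu).rep z) p q ↔
      HasRootPair (fun z => biform a u z) p q := by
  obtain ⟨t, ht⟩ := Projectivization.exists_smul_eq_mk_rep ℂ u hu
  have ht0 : (t : ℂ) ≠ 0 := t.ne_zero
  have h1 (z) : biform a (Projectivization.mk ℂ u hu).rep z = t ^ 2 * biform a u z := by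
    rw [← ht]
    change biform a ((t : ℂ) • u) z = _
    rw [← one_smul ℂ z, biform_smul, one_pow, mul_one]
    simp
  simp only [h1]
  refine ⟨fun h => ?_, fun h => h.const_mul (pow_ne_zero 2 ht0)⟩
  have h2 := h.const_mul (inv_ne_zero (pow_ne_zero 2 ht0))
  simpa [← mul_assoc, inv_mul_cancel₀ (pow_ne_zero 2 ht0)] using h2

theorem horizontalSwitch_mk {a : Matrix (Fin 3) (Fin 3) ℂ} {P : curve a} {u v w : Fin 2 → ℂ}
    (hu : u ≠ 0) (hv : v ≠ 0) (hw : w ≠ 0)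
    (hP : P.1 = (Projectivization.mk ℂ u hu, Projectivization.mk ℂ v hv)) {c : ℂ} (hc : c ≠ 0)
    (hF : ∀ z, biform a z v = c * (u 0 * z 1 - u 1 * z 0) * (w 0 * z 1 - w 1 * z 0)) :
    (horizontalSwitch a P).1 = (Projectivization.mk ℂ w hw, Projectivization.mk ℂ v hv) := by
  have h1 : P.1.2 = Projectivization.mk ℂ v hv := by rw [hP]
  rw [← h1]
  apply horizontalSwitch_eq
  rw [hP]
  exact (hasRootPair_biform_left a hv).2 (hasRootPair_mk hu hw hc hF)

theorem verticalSwitch_mk {a : Matrix (Fin 3) (Fin 3) ℂ} {P : curve a} {u v w : Fin 2 → ℂ}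
    (hu : u ≠ 0) (hv : v ≠ 0) (hw : w ≠ 0)
    (hP : P.1 = (Projectivization.mk ℂ u hu, Projectivization.mk ℂ v hv)) {c : ℂ} (hc : c ≠ 0)
    (hF : ∀ z, biform a u z = c * (v 0 * z 1 - v 1 * z 0) * (w 0 * z 1 - w 1 * z 0)) :
    (verticalSwitch a P).1 = (Projectivization.mk ℂ u hu, Projectivization.mk ℂ w hw) := by
  have h1 : P.1.1 = Projectivization.mk ℂ u hu := by rw [hP]
  rw [← h1]
  apply verticalSwitch_eq
  rw [hP]
  exact (hasRootPair_biform_right a hu).2 (hasRootPair_mk hv hw hc hF)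

end

end Biquadratic

/-! ### The curve with a fixed point of the horizontal switch at infinity -/

namespace Biquadratic

noncomputable section

theorem invD_eq (a : Matrix (Fin 3) (Fin 3) ℂ) : invD a =
    (a 1 0 ^ 2 - 4 * a 2 0 * a 0 0) * (a 1 2 ^ 2 - 4 * a 2 2 * a 0 2)
      + 3 * ((a 1 1 ^ 2 + 2 * a 1 2 * a 1 0
          - 4 * (a 2 2 * a 0 0 + a 2 1 * a 0 1 + a 2 0 * a 0 2)) / 6) ^ 2
      - 4 * ((2 * a 1 0 * a 1 1 - 4 * (a 2 1 * a 0 0 + a 2 0 * a 0 1)) / 4)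
        * ((2 * a 1 1 * a 1 2 - 4 * (a 2 2 * a 0 1 + a 2 1 * a 0 2)) / 4) := by
  obtain ⟨h0, h1, h2, h3, h4⟩ := discX_coeff a
  rw [invD, eisensteinD, h0, h1, h2, h3, h4]

theorem invE_eq (a : Matrix (Fin 3) (Fin 3) ℂ) : invE a =
    (a 1 0 ^ 2 - 4 * a 2 0 * a 0 0)
        * ((2 * a 1 1 * a 1 2 - 4 * (a 2 2 * a 0 1 + a 2 1 * a 0 2)) / 4) ^ 2
      + ((2 * a 1 0 * a 1 1 - 4 * (a 2 1 * a 0 0 + a 2 0 * a 0 1)) / 4) ^ 2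
        * (a 1 2 ^ 2 - 4 * a 2 2 * a 0 2)
      - (a 1 0 ^ 2 - 4 * a 2 0 * a 0 0)
        * ((a 1 1 ^ 2 + 2 * a 1 2 * a 1 0
          - 4 * (a 2 2 * a 0 0 + a 2 1 * a 0 1 + a 2 0 * a 0 2)) / 6)
        * (a 1 2 ^ 2 - 4 * a 2 2 * a 0 2)
      - 2 * ((2 * a 1 0 * a 1 1 - 4 * (a 2 1 * a 0 0 + a 2 0 * a 0 1)) / 4)
        * ((a 1 1 ^ 2 + 2 * a 1 2 * a 1 0
          - 4 * (a 2 2 * a 0 0 + a 2 1 * a 0 1 + a 2 0 * a 0 2)) / 6)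
        * ((2 * a 1 1 * a 1 2 - 4 * (a 2 2 * a 0 1 + a 2 1 * a 0 2)) / 4)
      + ((a 1 1 ^ 2 + 2 * a 1 2 * a 1 0
          - 4 * (a 2 2 * a 0 0 + a 2 1 * a 0 1 + a 2 0 * a 0 2)) / 6) ^ 3 := by
  obtain ⟨h0, h1, h2, h3, h4⟩ := discX_coeff a
  rw [invE, eisensteinE, h0, h1, h2, h3, h4]

/-- The polynomial `4x³ - D x + E` of a smooth cubic has no multiple root. -/
theorem IsSmoothCubic.root_simple {a : Matrix (Fin 3) (Fin 3) ℂ} (hs : IsSmoothCubic a) {x : ℂ}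
    (hx : 4 * x ^ 3 - invD a * x + invE a = 0) : 12 * x ^ 2 ≠ invD a := by
  intro h
  have h1 := weierstrass_nonsingular a hs x 0 ((weierstrass_equation a x 0).2 (by
    rw [hx]; ring))
  rw [WeierstrassCurve.Affine.nonsingular_iff'] at h1
  simp only [weierstrass] at h1
  rcases h1.2 with h2 | h2
  · apply h2
    linear_combination -h / 4
  · apply h2
    ring

/-- The normal form: the form has the double root `x = ∞` at `y = ∞`, so that the point `(∞, ∞)`
lies on the curve and is fixed by the horizontal switch. -/
structure IsNormalForm (a : Matrix (Fin 3) (Fin 3) ℂ) : Prop where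
  smooth : IsSmoothCubic a
  coeff_two_two : a 2 2 = 0
  coeff_one_two : a 1 2 = 0

namespace IsNormalForm

variable {a : Matrix (Fin 3) (Fin 3) ℂ}

theorem coeff_ne_zero (ha : IsNormalForm a) : a 2 1 ≠ 0 ∧ a 0 2 ≠ 0 := by
  rw [← mul_ne_zero_iff]
  intro h
  -- otherwise the discriminant has degree at most two in `y`, a double root at infinity
  have hD := invD_eq a
  have hE := invE_eq a
  rw [ha.coeff_two_two, ha.coeff_one_two] at hD hE
  have h3 : (2 * a 1 1 * 0 - 4 * (0 * a 0 1 + a 2 1 * a 0 2)) / 4 = 0 := by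
    linear_combination -h
  rw [h3] at hD hE
  generalize (a 1 1 ^ 2 + 2 * 0 * a 1 0
          - 4 * (0 * a 0 0 + a 2 1 * a 0 1 + a 2 0 * a 0 2)) / 6 = t at hD hE
  have hD' : invD a = 3 * t ^ 2 := by linear_combination hD
  have hE' : invE a = t ^ 3 := by linear_combination hE
  refine ha.smooth.root_simple (x := t / 2) ?_ ?_
  · rw [hD', hE']
    ring
  · rw [hD']
    ring

end IsNormalForm

/-- The abscissa of the point of the cubic above the coordinate `y`, on a curve in normal form: the
affine function of `y` that takes the discriminant, a cubic polynomial in `y`, to the form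
`4X³ - D X + E`, up to a constant factor. -/
def mapX (a : Matrix (Fin 3) (Fin 3) ℂ) (y : ℂ) : ℂ :=
  -(a 2 1 * a 0 2) * y + (a 1 1 ^ 2 - 4 * a 2 1 * a 0 1 - 4 * a 2 0 * a 0 2) / 12

/-- Half the ordinate of the point of the cubic that corresponds to `(x, y)`: the derivative of the
form with respect to `x`, a square root of the discriminant, up to a constant factor. -/
def mapY (a : Matrix (Fin 3) (Fin 3) ℂ) (x y : ℂ) : ℂ :=
  -(a 2 1 * a 0 2) * ((a 2 1 * y + a 2 0) * x + (a 1 1 * y + a 1 0) / 2)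

/-- The form on a curve in normal form at a finite point. -/
def affineForm (a : Matrix (Fin 3) (Fin 3) ℂ) (x y : ℂ) : ℂ :=
  (a 2 1 * y + a 2 0) * x ^ 2 + (a 1 1 * y + a 1 0) * x + (a 0 2 * y ^ 2 + a 0 1 * y + a 0 0)

namespace IsNormalForm

variable {a : Matrix (Fin 3) (Fin 3) ℂ}

theorem discriminant_eq (ha : IsNormalForm a) (y : ℂ) :
    4 * mapX a y ^ 3 - invD a * mapX a y + invE a = (a 2 1 * a 0 2) ^ 2 *
      ((a 1 1 * y + a 1 0) ^ 2
        - 4 * (a 2 1 * y + a 2 0) * (a 0 2 * y ^ 2 + a 0 1 * y + a 0 0)) := by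
  rw [invD_eq, invE_eq, ha.coeff_two_two, ha.coeff_one_two, mapX]
  ring

theorem discriminant_deriv_eq (ha : IsNormalForm a) (y : ℂ) :
    12 * mapX a y ^ 2 - invD a = -(a 2 1 * a 0 2) *
      (2 * a 1 1 * (a 1 1 * y + a 1 0) - 4 * a 2 1 * (a 0 2 * y ^ 2 + a 0 1 * y + a 0 0)
        - 4 * (a 2 1 * y + a 2 0) * (2 * a 0 2 * y + a 0 1)) := by
  rw [invD_eq, ha.coeff_two_two, ha.coeff_one_two, mapX]
  ring

theorem nonsingular (ha : IsNormalForm a) {x y : ℂ} (h : affineForm a x y = 0) :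
    (weierstrass a).Nonsingular (mapX a y) (mapY a x y) := by
  refine weierstrass_nonsingular a ha.smooth _ _ ((weierstrass_equation a _ _).2 ?_)
  rw [ha.discriminant_eq, mapY]
  rw [affineForm] at h
  linear_combination 4 * (a 2 1 * a 0 2) ^ 2 * (a 2 1 * y + a 2 0) * h

/-- At the value of `y` for which one root `x` is infinite, the two other coefficients of the
quadratic polynomial in `x` are not both zero. -/
theorem coeff_ne_zero_of_lead_eq_zero (ha : IsNormalForm a) {y : ℂ} (h2 : a 2 1 * y + a 2 0 = 0)
    (h1 : a 1 1 * y + a 1 0 = 0) : a 0 2 * y ^ 2 + a 0 1 * y + a 0 0 ≠ 0 := by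
  intro h0
  refine ha.smooth.root_simple (x := mapX a y) ?_ ?_
  · rw [ha.discriminant_eq, h0, h1]
    ring
  · rw [← sub_eq_zero, ha.discriminant_deriv_eq, h0, h1, h2]
    ring

theorem mapX_eq_ptX (ha : IsNormalForm a) {y : ℂ} (h : a 2 1 * y + a 2 0 = 0) :
    mapX a y = ptX a := by
  rw [mapX, ptX, ha.coeff_one_two, ha.coeff_two_two]
  linear_combination -a 0 2 * h

theorem ptY_eq (ha : IsNormalForm a) {y : ℂ} (h : a 2 1 * y + a 2 0 = 0) :
    ptY a = a 2 1 * a 0 2 * (a 1 1 * y + a 1 0) := by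
  rw [ptY, Matrix.det_fin_three, ha.coeff_one_two, ha.coeff_two_two]
  linear_combination -a 0 2 * a 1 1 * h

/-- Two points of the curve with the same coordinate `x` are mapped to points on a line through
`[1 : X : -Y]`, of slope proportional to an affine function of `x`. -/
theorem some_add_some (ha : IsNormalForm a) {x y y' : ℂ} (h : affineForm a x y = 0)
    (h' : affineForm a x y' = 0)
    (hyy : a 0 2 * (y + y') + (a 2 1 * x ^ 2 + a 1 1 * x + a 0 1) = 0) :
    (WeierstrassCurve.Affine.Point.some _ _ (ha.nonsingular h) : (weierstrass a).Point) +
      .some _ _ (ha.nonsingular h') = weierstrassPoint a ha.smooth := by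
  obtain ⟨hp, hq⟩ := ha.coeff_ne_zero
  have hr : a 2 1 * a 0 2 ≠ 0 := mul_ne_zero hp hq
  have hX : mapX a y = mapX a y' ↔ y = y' := by
    refine ⟨fun h1 => ?_, fun h1 => by rw [h1]⟩
    rw [mapX, mapX] at h1
    apply mul_left_cancel₀ hr
    linear_combination -h1
  -- if the two points coincide, they are not fixed by negation
  have hY : y = y' → mapY a x y' ≠ 0 := by
    rintro rfl h0
    have h1 := (weierstrass_equation a _ _).1 (ha.nonsingular h).1
    rw [h0, mul_zero] at h1
    refine ha.smooth.root_simple (x := mapX a y) (by linear_combination -h1) ?_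
    rw [← sub_eq_zero, ha.discriminant_deriv_eq]
    rw [mapY] at h0
    rw [affineForm] at h
    linear_combination (4 * a 2 1 * (a 2 1 * a 0 2)) * h +
      4 * (a 2 1 * a 0 2) * (a 2 1 * y + a 2 0) * hyy + 8 * (a 2 1 * x + a 1 1 / 2) * h0
  have hneg : (weierstrass a).negY (mapX a y') (mapY a x y') = -mapY a x y' := by
    simp [WeierstrassCurve.Affine.negY, weierstrass]
  have hxy : ¬ (mapX a y = mapX a y' ∧
      mapY a x y = (weierstrass a).negY (mapX a y') (mapY a x y')) := by
    rintro ⟨h1, h2⟩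
    rw [hX] at h1
    subst h1
    rw [hneg] at h2
    exact hY rfl (by linear_combination h2 / 2)
  have hslope : (weierstrass a).slope (mapX a y) (mapX a y') (mapY a x y) (mapY a x y') =
      a 2 1 * x + a 1 1 / 2 := by
    by_cases hy : y = y'
    · subst hy
      rw [WeierstrassCurve.Affine.slope_of_Y_ne rfl (fun h2 => hxy ⟨rfl, h2⟩), hneg]
      have h0 := hY rfl
      rw [div_eq_iff (by intro h1; apply h0; linear_combination h1 / 2)]
      have h1 := ha.discriminant_deriv_eq y
      simp only [weierstrass]
      rw [mapY]
      rw [affineForm] at h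
      linear_combination h1 / 4 + (a 2 1 * (a 2 1 * a 0 2)) * h +
        (a 2 1 * a 0 2) * (a 2 1 * y + a 2 0) * hyy
    · rw [WeierstrassCurve.Affine.slope_of_X_ne (fun h1 => hy (hX.1 h1)),
        div_eq_iff (sub_ne_zero.2 fun h1 => hy (hX.1 h1)), mapY, mapY, mapX, mapX]
      ring
  have hy0 : a 2 1 * (-a 2 0 / a 2 1) + a 2 0 = 0 := by field_simp; ring
  have hptX := ha.mapX_eq_ptX hy0
  have hptY := ha.ptY_eq hy0
  rw [mapX] at hptX
  have e : a 2 1 * (-a 2 0 / a 2 1) = - a 2 0 := by field_simp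
  have haddX : (weierstrass a).addX (mapX a y) (mapX a y') (a 2 1 * x + a 1 1 / 2) = ptX a := by
    rw [← hptX]
    simp only [WeierstrassCurve.Affine.addX, weierstrass, mapX]
    linear_combination a 2 1 * hyy + a 0 2 * e
  rw [WeierstrassCurve.Affine.Point.add_some hxy, weierstrassPoint,
    WeierstrassCurve.Affine.Point.some.injEq, hslope]
  refine ⟨haddX, ?_⟩
  rw [WeierstrassCurve.Affine.addY, WeierstrassCurve.Affine.negAddY, haddX, hptY, ← hptX]
  simp only [WeierstrassCurve.Affine.negY, weierstrass, mapX, mapY]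
  linear_combination (a 0 2 * (a 2 1 * x + a 1 1 / 2) - a 1 1 * a 0 2 / 2) * e

end IsNormalForm

end

end Biquadratic

/-! ### The curve in normal form and the cubic -/

namespace Biquadratic

noncomputable section

theorem finPt_ne_zero (x : ℂ) : (![1, x] : Fin 2 → ℂ) ≠ 0 := fun h => one_ne_zero (congrFun h 0)

theorem infPt_ne_zero : (![0, 1] : Fin 2 → ℂ) ≠ 0 := fun h => one_ne_zero (congrFun h 1)

/-- The affine coordinate of a point of the projective line other than `[0 : 1]`. -/
def coord (p : ℙ ℂ (Fin 2 → ℂ)) : ℂ := p.rep 1 / p.rep 0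

theorem coord_finPt (x : ℂ) : coord (finPt x) = x := by
  obtain ⟨t, ht⟩ := Projectivization.exists_smul_eq_mk_rep ℂ ![1, x] (finPt_ne_zero x)
  rw [coord, finPt, ← ht]
  change (t * x : ℂ) / (t * 1) = x
  have : (t : ℂ) ≠ 0 := t.ne_zero
  field_simp

namespace IsNormalForm

variable {a : Matrix (Fin 3) (Fin 3) ℂ}

theorem biform_eq (ha : IsNormalForm a) (u v : Fin 2 → ℂ) : biform a u v =
    (a 2 1 * v 1 * v 0 + a 2 0 * v 0 ^ 2) * u 1 ^ 2
    + (a 1 1 * v 1 * v 0 + a 1 0 * v 0 ^ 2) * u 1 * u 0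
    + (a 0 2 * v 1 ^ 2 + a 0 1 * v 1 * v 0 + a 0 0 * v 0 ^ 2) * u 0 ^ 2 := by
  rw [Biquadratic.biform_eq, ha.coeff_one_two, ha.coeff_two_two]
  ring

theorem finPt_finPt_mem_curve (ha : IsNormalForm a) {x y : ℂ} :
    (finPt x, finPt y) ∈ curve a ↔ affineForm a x y = 0 := by
  rw [finPt, finPt, mk_mem_curve, ha.biform_eq, affineForm]
  simp

theorem infPt_finPt_mem_curve (ha : IsNormalForm a) {y : ℂ} :
    (infPt, finPt y) ∈ curve a ↔ a 2 1 * y + a 2 0 = 0 := by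
  rw [finPt, infPt, mk_mem_curve, ha.biform_eq]
  simp

theorem finPt_infPt_not_mem_curve (ha : IsNormalForm a) {x : ℂ} :
    (finPt x, infPt) ∉ curve a := by
  rw [finPt, infPt, mk_mem_curve, ha.biform_eq]
  simpa using ha.coeff_ne_zero.2

theorem infPt_infPt_mem_curve (ha : IsNormalForm a) : (infPt, infPt) ∈ curve a := by
  rw [infPt, mk_mem_curve, ha.biform_eq]
  simp

/-- The curve consists of finite points, of `(∞, ∞)` and of `(∞, y)` for one finite `y`. -/
theorem cases_curve (ha : IsNormalForm a) (P : curve a) :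
    P.1 = (infPt, infPt) ∨ (∃ y, P.1 = (infPt, finPt y) ∧ a 2 1 * y + a 2 0 = 0) ∨
      ∃ x y, P.1 = (finPt x, finPt y) ∧ affineForm a x y = 0 := by
  obtain ⟨⟨p, q⟩, hP⟩ := P
  rcases eq_infPt_or_eq_finPt p with rfl | ⟨x, rfl⟩ <;>
    rcases eq_infPt_or_eq_finPt q with rfl | ⟨y, rfl⟩
  · exact Or.inl rfl
  · exact Or.inr (Or.inl ⟨y, rfl, ha.infPt_finPt_mem_curve.1 hP⟩)
  · exact absurd hP ha.finPt_infPt_not_mem_curve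
  · exact Or.inr (Or.inr ⟨x, y, rfl, ha.finPt_finPt_mem_curve.1 hP⟩)

theorem affineForm_coord (ha : IsNormalForm a) (P : curve a) (h1 : P.1.1 ≠ infPt) :
    affineForm a (coord P.1.1) (coord P.1.2) = 0 := by
  rcases ha.cases_curve P with h | ⟨y, h, -⟩ | ⟨x, y, h, hxy⟩
  · rw [h] at h1
    exact absurd rfl h1
  · rw [h] at h1
    exact absurd rfl h1
  · rw [h, coord_finPt, coord_finPt]
    exact hxy

open Classical in
/-- The isomorphism from a curve in normal form to the Weierstrass model of `Γ` that takes `(∞, ∞)`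
to zero. -/
def toWeierstrass (ha : IsNormalForm a) (P : curve a) : (weierstrass a).Point :=
  if P.1.2 = infPt then 0 else
  if h1 : P.1.1 = infPt then weierstrassPoint a ha.smooth else
  .some _ _ (ha.nonsingular (ha.affineForm_coord P h1))

theorem toWeierstrass_infPt (ha : IsNormalForm a) {P : curve a} (h : P.1 = (infPt, infPt)) :
    ha.toWeierstrass P = 0 := by
  rw [toWeierstrass, if_pos (by rw [h])]

theorem toWeierstrass_infPt_finPt (ha : IsNormalForm a) {P : curve a} {y : ℂ}
    (h : P.1 = (infPt, finPt y)) : ha.toWeierstrass P = weierstrassPoint a ha.smooth := by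
  rw [toWeierstrass, if_neg (by rw [h]; exact finPt_ne_infPt y), dif_pos (by rw [h])]

theorem toWeierstrass_finPt (ha : IsNormalForm a) {P : curve a} {x y : ℂ}
    (h : P.1 = (finPt x, finPt y)) (hxy : affineForm a x y = 0) :
    ha.toWeierstrass P = .some _ _ (ha.nonsingular hxy) := by
  rw [toWeierstrass, if_neg (by rw [h]; exact finPt_ne_infPt y),
    dif_neg (by rw [h]; exact finPt_ne_infPt x), WeierstrassCurve.Affine.Point.some.injEq, h,
    coord_finPt, coord_finPt]
  exact ⟨rfl, rfl⟩

theorem mapX_injective (ha : IsNormalForm a) : Function.Injective (mapX a) := by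
  intro y y' h
  rw [mapX, mapX] at h
  apply mul_left_cancel₀ (mul_ne_zero ha.coeff_ne_zero.1 ha.coeff_ne_zero.2)
  linear_combination -h

/-- A finite point is not mapped to the same point as `(∞, y)`. -/
theorem some_ne_weierstrassPoint (ha : IsNormalForm a) {x y y' : ℂ} (h : affineForm a x y = 0)
    (hy' : a 2 1 * y' + a 2 0 = 0) :
    (WeierstrassCurve.Affine.Point.some _ _ (ha.nonsingular h) : (weierstrass a).Point) ≠
      weierstrassPoint a ha.smooth := by
  intro he
  rw [weierstrassPoint, WeierstrassCurve.Affine.Point.some.injEq] at he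
  obtain ⟨h1, h2⟩ := he
  rw [← ha.mapX_eq_ptX hy'] at h1
  obtain rfl := ha.mapX_injective h1
  rw [ha.ptY_eq hy', mapY, hy'] at h2
  have hB : a 1 1 * y + a 1 0 = 0 := by
    apply mul_left_cancel₀ (mul_ne_zero ha.coeff_ne_zero.1 ha.coeff_ne_zero.2)
    linear_combination -h2
  apply ha.coeff_ne_zero_of_lead_eq_zero hy' hB
  rw [affineForm] at h
  linear_combination h - x ^ 2 * hy' - x * hB

theorem toWeierstrass_injective (ha : IsNormalForm a) :
    Function.Injective ha.toWeierstrass := by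
  intro P P' he
  have h0 (x y) (h : affineForm a x y = 0) :
      (WeierstrassCurve.Affine.Point.some _ _ (ha.nonsingular h) : (weierstrass a).Point) ≠ 0 :=
    WeierstrassCurve.Affine.Point.some_ne_zero _
  have hT : weierstrassPoint a ha.smooth ≠ 0 := WeierstrassCurve.Affine.Point.some_ne_zero _
  apply Subtype.ext
  rcases ha.cases_curve P with h | ⟨y, h, hy⟩ | ⟨x, y, h, hxy⟩ <;>
    rcases ha.cases_curve P' with h' | ⟨y', h', hy'⟩ | ⟨x', y', h', hxy'⟩
  · rw [h, h']
  · rw [ha.toWeierstrass_infPt h, ha.toWeierstrass_infPt_finPt h'] at he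
    exact absurd he.symm hT
  · rw [ha.toWeierstrass_infPt h, ha.toWeierstrass_finPt h' hxy'] at he
    exact absurd he.symm (h0 _ _ ‹_›)
  · rw [ha.toWeierstrass_infPt h', ha.toWeierstrass_infPt_finPt h] at he
    exact absurd he hT
  · have : y = y' := by
      apply mul_left_cancel₀ ha.coeff_ne_zero.1
      linear_combination hy - hy'
    rw [h, h', this]
  · rw [ha.toWeierstrass_infPt_finPt h, ha.toWeierstrass_finPt h' hxy'] at he
    exact absurd he.symm (ha.some_ne_weierstrassPoint hxy' hy)
  · rw [ha.toWeierstrass_infPt h', ha.toWeierstrass_finPt h hxy] at he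
    exact absurd he (h0 _ _ ‹_›)
  · rw [ha.toWeierstrass_infPt_finPt h', ha.toWeierstrass_finPt h hxy] at he
    exact absurd he (ha.some_ne_weierstrassPoint hxy hy')
  · rw [ha.toWeierstrass_finPt h' hxy', ha.toWeierstrass_finPt h hxy,
      WeierstrassCurve.Affine.Point.some.injEq] at he
    obtain rfl := ha.mapX_injective he.1
    have h2 := he.2
    rw [mapY, mapY] at h2
    have h3 := mul_left_cancel₀
      (neg_ne_zero.2 (mul_ne_zero ha.coeff_ne_zero.1 ha.coeff_ne_zero.2)) h2
    have hx : x = x' := by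
      by_cases hA : a 2 1 * y + a 2 0 = 0
      · have hB : a 1 1 * y + a 1 0 ≠ 0 := by
          intro hB
          apply ha.coeff_ne_zero_of_lead_eq_zero hA hB
          rw [affineForm] at hxy
          linear_combination hxy - x ^ 2 * hA - x * hB
        apply mul_left_cancel₀ hB
        rw [affineForm] at hxy hxy'
        linear_combination hxy - hxy' - (x ^ 2 - x' ^ 2) * hA
      · apply mul_left_cancel₀ hA
        linear_combination h3
    rw [h, h', hx]

/-- The horizontal switch becomes negation, since the two roots `x` of the form have opposite
derivatives. -/
theorem toWeierstrass_horizontalSwitch (ha : IsNormalForm a) (P : curve a) :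
    ha.toWeierstrass (horizontalSwitch a P) = -ha.toWeierstrass P := by
  obtain ⟨hp, hq⟩ := ha.coeff_ne_zero
  have hneg (x y : ℂ) : (weierstrass a).negY x y = -y := by
    simp [WeierstrassCurve.Affine.negY, weierstrass]
  rcases ha.cases_curve P with h | ⟨y, h, hy⟩ | ⟨x, y, h, hxy⟩
  · -- `(∞, ∞)` is fixed
    have h1 := horizontalSwitch_mk infPt_ne_zero infPt_ne_zero infPt_ne_zero h hq (fun z => by
      rw [ha.biform_eq]
      simp only [Matrix.cons_val_zero, Matrix.cons_val_one]
      ring)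
    rw [ha.toWeierstrass_infPt h, ha.toWeierstrass_infPt h1, neg_zero]
  · rw [ha.toWeierstrass_infPt_finPt h]
    by_cases hB : a 1 1 * y + a 1 0 = 0
    · -- the root `∞` is double, and the translation point has order two
      have h1 := horizontalSwitch_mk infPt_ne_zero (finPt_ne_zero y) infPt_ne_zero h
        (ha.coeff_ne_zero_of_lead_eq_zero hy hB) (fun z => by
          rw [ha.biform_eq]
          simp only [Matrix.cons_val_zero, Matrix.cons_val_one]
          linear_combination z 1 ^ 2 * hy + z 1 * z 0 * hB)
      rw [ha.toWeierstrass_infPt_finPt h1, weierstrassPoint,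
        WeierstrassCurve.Affine.Point.neg_some, WeierstrassCurve.Affine.Point.some.injEq, hneg,
        ha.ptY_eq hy, hB]
      simp
    · set x := -(a 0 2 * y ^ 2 + a 0 1 * y + a 0 0) / (a 1 1 * y + a 1 0) with hx
      have hx' : (a 1 1 * y + a 1 0) * x = -(a 0 2 * y ^ 2 + a 0 1 * y + a 0 0) := by
        rw [hx]
        field_simp
      have h1 := horizontalSwitch_mk infPt_ne_zero (finPt_ne_zero y) (finPt_ne_zero x) h
        (neg_ne_zero.2 hB) (fun z => by
          rw [ha.biform_eq]
          simp only [Matrix.cons_val_zero, Matrix.cons_val_one]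
          linear_combination z 1 ^ 2 * hy + z 0 ^ 2 * hx')
      have hxy : affineForm a x y = 0 := by
        rw [affineForm]
        linear_combination x ^ 2 * hy + hx'
      rw [ha.toWeierstrass_finPt h1 hxy, weierstrassPoint,
        WeierstrassCurve.Affine.Point.neg_some, WeierstrassCurve.Affine.Point.some.injEq, hneg]
      refine ⟨ha.mapX_eq_ptX hy, ?_⟩
      rw [ha.ptY_eq hy, mapY, hy]
      ring
  · rw [ha.toWeierstrass_finPt h hxy]
    have hxy0 := hxy
    rw [affineForm] at hxy
    by_cases hA : a 2 1 * y + a 2 0 = 0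
    · have hB : a 1 1 * y + a 1 0 ≠ 0 := by
        intro hB
        apply ha.coeff_ne_zero_of_lead_eq_zero hA hB
        linear_combination hxy - x ^ 2 * hA - x * hB
      have h1 := horizontalSwitch_mk (finPt_ne_zero x) (finPt_ne_zero y) infPt_ne_zero h
        (neg_ne_zero.2 hB) (fun z => by
          rw [ha.biform_eq]
          simp only [Matrix.cons_val_zero, Matrix.cons_val_one]
          linear_combination (z 1 ^ 2 - x ^ 2 * z 0 ^ 2) * hA + z 0 ^ 2 * hxy)
      rw [ha.toWeierstrass_infPt_finPt h1, weierstrassPoint,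
        WeierstrassCurve.Affine.Point.neg_some, WeierstrassCurve.Affine.Point.some.injEq, hneg]
      refine ⟨(ha.mapX_eq_ptX hA).symm, ?_⟩
      rw [ha.ptY_eq hA, mapY, hA]
      ring
    · set x' := -(a 1 1 * y + a 1 0) / (a 2 1 * y + a 2 0) - x with hx'
      have hxx : (a 2 1 * y + a 2 0) * x' =
          -(a 1 1 * y + a 1 0) - (a 2 1 * y + a 2 0) * x := by
        rw [hx', mul_sub, mul_div_cancel₀ _ hA]
      have h1 := horizontalSwitch_mk (finPt_ne_zero x) (finPt_ne_zero y) (finPt_ne_zero x') h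
        hA (fun z => by
          rw [ha.biform_eq]
          simp only [Matrix.cons_val_zero, Matrix.cons_val_one]
          linear_combination (z 1 * z 0 - x * z 0 ^ 2) * hxx + z 0 ^ 2 * hxy)
      have hxy' : affineForm a x' y = 0 := by
        rw [affineForm]
        linear_combination (x' - x) * hxx + hxy
      rw [ha.toWeierstrass_finPt h1 hxy',
        WeierstrassCurve.Affine.Point.neg_some, WeierstrassCurve.Affine.Point.some.injEq, hneg]
      refine ⟨rfl, ?_⟩
      rw [mapY, mapY]
      linear_combination (-(a 2 1 * a 0 2)) * hxx

/-- The vertical switch becomes `P ↦ T - P`, with `T` the point `[1 : X : Y]`. -/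
theorem toWeierstrass_verticalSwitch (ha : IsNormalForm a) (P : curve a) :
    ha.toWeierstrass (verticalSwitch a P) + ha.toWeierstrass P = weierstrassPoint a ha.smooth := by
  obtain ⟨hp, hq⟩ := ha.coeff_ne_zero
  rcases ha.cases_curve P with h | ⟨y, h, hy⟩ | ⟨x, y, h, hxy⟩
  · have h1 := verticalSwitch_mk infPt_ne_zero infPt_ne_zero (finPt_ne_zero (-a 2 0 / a 2 1)) h
      (neg_ne_zero.2 hp) (fun z => by
        rw [ha.biform_eq]
        simp only [Matrix.cons_val_zero, Matrix.cons_val_one]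
        field_simp
        ring)
    rw [ha.toWeierstrass_infPt h, ha.toWeierstrass_infPt_finPt h1, add_zero]
  · have h1 := verticalSwitch_mk infPt_ne_zero (finPt_ne_zero y) infPt_ne_zero h
      (neg_ne_zero.2 hp) (fun z => by
        rw [ha.biform_eq]
        simp only [Matrix.cons_val_zero, Matrix.cons_val_one]
        linear_combination z 0 ^ 2 * hy)
    rw [ha.toWeierstrass_infPt_finPt h, ha.toWeierstrass_infPt h1, zero_add]
  · set y' := -(a 2 1 * x ^ 2 + a 1 1 * x + a 0 1) / a 0 2 - y with hy'
    have hyy : a 0 2 * (y' + y) + (a 2 1 * x ^ 2 + a 1 1 * x + a 0 1) = 0 := by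
      rw [hy', sub_add_cancel, mul_div_cancel₀ _ hq]
      ring
    have hxy0 := hxy
    rw [affineForm] at hxy
    have h1 := verticalSwitch_mk (finPt_ne_zero x) (finPt_ne_zero y) (finPt_ne_zero y') h
      hq (fun z => by
        rw [ha.biform_eq]
        simp only [Matrix.cons_val_zero, Matrix.cons_val_one]
        linear_combination (z 1 * z 0 - y * z 0 ^ 2) * hyy + z 0 ^ 2 * hxy)
    have hxy' : affineForm a x y' = 0 := by
      rw [affineForm]
      linear_combination (y' - y) * hyy + hxy
    rw [ha.toWeierstrass_finPt h hxy0, ha.toWeierstrass_finPt h1 hxy']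
    exact ha.some_add_some hxy' hxy0 hyy

theorem toWeierstrass_qrt (ha : IsNormalForm a) (P : curve a) :
    ha.toWeierstrass (qrt a P) = ha.toWeierstrass P + weierstrassPoint a ha.smooth := by
  have h1 := ha.toWeierstrass_verticalSwitch (horizontalSwitch a P)
  rw [ha.toWeierstrass_horizontalSwitch] at h1
  rw [← h1]
  change ha.toWeierstrass (verticalSwitch a (horizontalSwitch a P)) = _
  abel

theorem toWeierstrass_qrt_pow (ha : IsNormalForm a) (n : ℕ) (P : curve a) :
    ha.toWeierstrass ((qrt a ^ n) P) = ha.toWeierstrass P + n • weierstrassPoint a ha.smooth := by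
  induction n with
  | zero =>
    rw [zero_nsmul, add_zero]
    rfl
  | succ n ih =>
    rw [pow_succ']
    change ha.toWeierstrass (qrt a ((qrt a ^ n) P)) = _
    rw [ha.toWeierstrass_qrt, ih, succ_nsmul, add_assoc]

theorem qrt_pow_eq_one_iff (ha : IsNormalForm a) (n : ℕ) :
    qrt a ^ n = 1 ↔ n • weierstrassPoint a ha.smooth = 0 := by
  constructor
  · intro h
    have h1 := ha.toWeierstrass_qrt_pow n ⟨_, ha.infPt_infPt_mem_curve⟩
    rw [h] at h1
    exact left_eq_add.1 h1
  · intro h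
    refine funext fun P => ?_
    apply ha.toWeierstrass_injective
    rw [ha.toWeierstrass_qrt_pow, h, add_zero]
    rfl

end IsNormalForm

end

end Biquadratic

/-! ### Linear changes of coordinates -/

namespace Biquadratic

noncomputable section

open Matrix (SpecialLinearGroup)

theorem smul_apply_zero (g : SpecialLinearGroup (Fin 2) ℂ) (v : Fin 2 → ℂ) :
    (g • v) 0 = g 0 0 * v 0 + g 0 1 * v 1 := by
  simp [Matrix.SpecialLinearGroup.smul_def, Matrix.mulVec, dotProduct, Fin.sum_univ_two]

theorem smul_apply_one (g : SpecialLinearGroup (Fin 2) ℂ) (v : Fin 2 → ℂ) :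
    (g • v) 1 = g 1 0 * v 0 + g 1 1 * v 1 := by
  simp [Matrix.SpecialLinearGroup.smul_def, Matrix.mulVec, dotProduct, Fin.sum_univ_two]

theorem specialLinearGroup_det_eq (g : SpecialLinearGroup (Fin 2) ℂ) :
    g 0 0 * g 1 1 - g 0 1 * g 1 0 = 1 := by
  rw [← Matrix.det_fin_two, g.det_coe]

theorem HasRootPair.of_smul {F : (Fin 2 → ℂ) → ℂ} {p q : ℙ ℂ (Fin 2 → ℂ)}
    (g : SpecialLinearGroup (Fin 2) ℂ) (h : HasRootPair F (g • p) (g • q)) :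
    HasRootPair (fun z => F (g • z)) p q := by
  induction p with
  | h u hu =>
    induction q with
    | h w hw =>
      rw [Projectivization.smul_mk, Projectivization.smul_mk] at h
      obtain ⟨s, hs⟩ := Projectivization.exists_smul_eq_mk_rep ℂ (g • u)
        ((smul_ne_zero_iff_ne g).2 hu)
      obtain ⟨t, ht⟩ := Projectivization.exists_smul_eq_mk_rep ℂ (g • w)
        ((smul_ne_zero_iff_ne g).2 hw)
      obtain ⟨c, hc, h⟩ := h
      refine hasRootPair_mk hu hw (c := c * s * t)
        (mul_ne_zero (mul_ne_zero hc s.ne_zero) t.ne_zero) fun z => ?_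
      have hdet := specialLinearGroup_det_eq g
      -- the action preserves the determinant of two vectors
      have hwedge (v : Fin 2 → ℂ) :
          (g • v) 0 * (g • z) 1 - (g • v) 1 * (g • z) 0 = v 0 * z 1 - v 1 * z 0 := by
        simp only [smul_apply_zero, smul_apply_one]
        linear_combination (v 0 * z 1 - v 1 * z 0) * hdet
      rw [h, ← hs, ← ht, ← hwedge u, ← hwedge w]
      change c * (((s : ℂ) * (g • u) 0) * (g • z) 1 - ((s : ℂ) * (g • u) 1) * (g • z) 0) *
        (((t : ℂ) * (g • w) 0) * (g • z) 1 - ((t : ℂ) * (g • w) 1) * (g • z) 0) = _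
      ring

theorem hasRootPair_smul_iff {F : (Fin 2 → ℂ) → ℂ} {p q : ℙ ℂ (Fin 2 → ℂ)}
    (g : SpecialLinearGroup (Fin 2) ℂ) :
    HasRootPair F (g • p) (g • q) ↔ HasRootPair (fun z => F (g • z)) p q := by
  refine ⟨fun h => h.of_smul g, fun h => ?_⟩
  rw [← inv_smul_smul g p, ← inv_smul_smul g q] at h
  simpa using h.of_smul g⁻¹

section Conjugation

variable {a a' : Matrix (Fin 3) (Fin 3) ℂ} {g₁ g₂ : SpecialLinearGroup (Fin 2) ℂ}

theorem smul_mem_curve_iff (h : ∀ u v, biform a' u v = biform a (g₁ • u) (g₂ • v))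
    (P : ℙ ℂ (Fin 2 → ℂ) × ℙ ℂ (Fin 2 → ℂ)) : P ∈ curve a' ↔ (g₁ • P.1, g₂ • P.2) ∈ curve a := by
  obtain ⟨p, q⟩ := P
  induction p with
  | h u hu =>
    induction q with
    | h v hv =>
      rw [mk_mem_curve, h, Projectivization.smul_mk, Projectivization.smul_mk, mk_mem_curve]

/-- The isomorphism of curves induced by a linear change of coordinates on each line. -/
def curveEquiv (h : ∀ u v, biform a' u v = biform a (g₁ • u) (g₂ • v)) : curve a' ≃ curve a :=
  ((MulAction.toPerm g₁).prodCongr (MulAction.toPerm g₂)).subtypeEquiv (smul_mem_curve_iff h)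

theorem curveEquiv_apply (h : ∀ u v, biform a' u v = biform a (g₁ • u) (g₂ • v)) (P : curve a') :
    (curveEquiv h P).1 = (g₁ • P.1.1, g₂ • P.1.2) := rfl

theorem curveEquiv_horizontalSwitch (h : ∀ u v, biform a' u v = biform a (g₁ • u) (g₂ • v))
    (P : curve a') :
    curveEquiv h (horizontalSwitch a' P) = horizontalSwitch a (curveEquiv h P) := by
  have key (q) : HasRootPair (fun z => biform a z (curveEquiv h P).1.2.rep) (curveEquiv h P).1.1
      (g₁ • q) ↔ HasRootPair (fun z => biform a' z P.1.2.rep) P.1.1 q := by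
    rw [curveEquiv_apply, hasRootPair_smul_iff]
    have e : g₂ • P.1.2 = Projectivization.mk ℂ (g₂ • P.1.2.rep)
      ((smul_ne_zero_iff_ne g₂).2 P.1.2.rep_nonzero) := (congrArg (g₂ • ·) P.1.2.mk_rep).symm
    have h1 := hasRootPair_biform_left a
      ((smul_ne_zero_iff_ne g₂).2 P.1.2.rep_nonzero) (p := g₁ • P.1.1) (q := g₁ • q)
    rw [hasRootPair_smul_iff, hasRootPair_smul_iff, ← e] at h1
    simp only [h]
    exact h1
  by_cases hex : ∃ q, HasRootPair (fun z => biform a' z P.1.2.rep) P.1.1 q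
  · obtain ⟨q, hq⟩ := hex
    apply Subtype.ext
    rw [horizontalSwitch_eq ((key q).2 hq), curveEquiv_apply, horizontalSwitch_eq hq]
    rfl
  · have hex' : ¬ ∃ q, HasRootPair (fun z => biform a z (curveEquiv h P).1.2.rep)
        (curveEquiv h P).1.1 q := by
      rintro ⟨q, hq⟩
      exact hex ⟨g₁⁻¹ • q, (key _).1 (by rwa [smul_inv_smul])⟩
    rw [horizontalSwitch, dif_neg hex, horizontalSwitch, dif_neg hex']

theorem curveEquiv_verticalSwitch (h : ∀ u v, biform a' u v = biform a (g₁ • u) (g₂ • v))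
    (P : curve a') :
    curveEquiv h (verticalSwitch a' P) = verticalSwitch a (curveEquiv h P) := by
  have key (q) : HasRootPair (fun z => biform a (curveEquiv h P).1.1.rep z) (curveEquiv h P).1.2
      (g₂ • q) ↔ HasRootPair (fun z => biform a' P.1.1.rep z) P.1.2 q := by
    rw [curveEquiv_apply, hasRootPair_smul_iff]
    have e : g₁ • P.1.1 = Projectivization.mk ℂ (g₁ • P.1.1.rep)
      ((smul_ne_zero_iff_ne g₁).2 P.1.1.rep_nonzero) := (congrArg (g₁ • ·) P.1.1.mk_rep).symm
    have h1 := hasRootPair_biform_right a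
      ((smul_ne_zero_iff_ne g₁).2 P.1.1.rep_nonzero) (p := g₂ • P.1.2) (q := g₂ • q)
    rw [hasRootPair_smul_iff, hasRootPair_smul_iff, ← e] at h1
    simp only [h]
    exact h1
  by_cases hex : ∃ q, HasRootPair (fun z => biform a' P.1.1.rep z) P.1.2 q
  · obtain ⟨q, hq⟩ := hex
    apply Subtype.ext
    rw [verticalSwitch_eq ((key q).2 hq), curveEquiv_apply, verticalSwitch_eq hq]
    rfl
  · have hex' : ¬ ∃ q, HasRootPair (fun z => biform a (curveEquiv h P).1.1.rep z)
        (curveEquiv h P).1.2 q := by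
      rintro ⟨q, hq⟩
      exact hex ⟨g₂⁻¹ • q, (key _).1 (by rwa [smul_inv_smul])⟩
    rw [verticalSwitch, dif_neg hex, verticalSwitch, dif_neg hex']

theorem curveEquiv_qrt_pow (h : ∀ u v, biform a' u v = biform a (g₁ • u) (g₂ • v)) (n : ℕ)
    (P : curve a') : curveEquiv h ((qrt a' ^ n) P) = (qrt a ^ n) (curveEquiv h P) := by
  induction n with
  | zero => rfl
  | succ n ih =>
    rw [pow_succ', pow_succ']
    change curveEquiv h (verticalSwitch a' (horizontalSwitch a' ((qrt a' ^ n) P))) =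
      verticalSwitch a (horizontalSwitch a ((qrt a ^ n) (curveEquiv h P)))
    rw [curveEquiv_verticalSwitch, curveEquiv_horizontalSwitch, ih]

theorem qrt_pow_eq_one_iff_of_biform_eq
    (h : ∀ u v, biform a' u v = biform a (g₁ • u) (g₂ • v)) (n : ℕ) :
    qrt a' ^ n = 1 ↔ qrt a ^ n = 1 := by
  constructor
  · intro h1
    refine funext fun P => ?_
    have h2 := curveEquiv_qrt_pow h n ((curveEquiv h).symm P)
    rw [h1, Equiv.apply_symm_apply] at h2
    rw [← h2]
    exact (curveEquiv h).apply_symm_apply P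
  · intro h1
    refine funext fun P => (curveEquiv h).injective ?_
    rw [curveEquiv_qrt_pow h n P, h1]
    rfl

end Conjugation

/-- The matrix of the substitution `x ↦ g x` on binary quadratic forms, with respect to the
monomials `x₀²`, `x₀ x₁`, `x₁²`. -/
def symSq (g : SpecialLinearGroup (Fin 2) ℂ) : Matrix (Fin 3) (Fin 3) ℂ :=
  !![g 0 0 ^ 2, 2 * g 0 0 * g 0 1, g 0 1 ^ 2;
     g 0 0 * g 1 0, g 0 0 * g 1 1 + g 0 1 * g 1 0, g 0 1 * g 1 1;
     g 1 0 ^ 2, 2 * g 1 0 * g 1 1, g 1 1 ^ 2]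

/-- The matrix of the biquadratic form after the substitution `x ↦ g x`. -/
def pullX (g : SpecialLinearGroup (Fin 2) ℂ) (a : Matrix (Fin 3) (Fin 3) ℂ) :
    Matrix (Fin 3) (Fin 3) ℂ := (symSq g).transpose * a

theorem pullX_apply (g : SpecialLinearGroup (Fin 2) ℂ) (a : Matrix (Fin 3) (Fin 3) ℂ)
    (j : Fin 3) :
    pullX g a 0 j = g 0 0 ^ 2 * a 0 j + g 0 0 * g 1 0 * a 1 j + g 1 0 ^ 2 * a 2 j ∧
    pullX g a 1 j = 2 * g 0 0 * g 0 1 * a 0 j + (g 0 0 * g 1 1 + g 0 1 * g 1 0) * a 1 j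
      + 2 * g 1 0 * g 1 1 * a 2 j ∧
    pullX g a 2 j = g 0 1 ^ 2 * a 0 j + g 0 1 * g 1 1 * a 1 j + g 1 1 ^ 2 * a 2 j := by
  simp [pullX, symSq, Matrix.mul_apply, Fin.sum_univ_three]

theorem biform_pullX (g : SpecialLinearGroup (Fin 2) ℂ) (a : Matrix (Fin 3) (Fin 3) ℂ)
    (u v : Fin 2 → ℂ) : biform (pullX g a) u v = biform a (g • u) v := by
  simp only [biform_eq, smul_apply_zero, smul_apply_one, pullX_apply]
  ring

theorem symSq_det (g : SpecialLinearGroup (Fin 2) ℂ) : (symSq g).det = 1 := by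
  have h := specialLinearGroup_det_eq g
  have h3 : (g 0 0 * g 1 1 - g 0 1 * g 1 0) ^ 3 = 1 := by rw [h, one_pow]
  rw [← h3, symSq, Matrix.det_fin_three]
  simp
  ring

theorem ptY_pullX (g : SpecialLinearGroup (Fin 2) ℂ) (a : Matrix (Fin 3) (Fin 3) ℂ) :
    ptY (pullX g a) = ptY a := by
  rw [ptY, pullX, Matrix.det_mul, Matrix.det_transpose, symSq_det, one_mul, ptY]

theorem ptX_pullX (g : SpecialLinearGroup (Fin 2) ℂ) (a : Matrix (Fin 3) (Fin 3) ℂ) :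
    ptX (pullX g a) = ptX a := by
  have h := specialLinearGroup_det_eq g
  have h2 : ptX (pullX g a) = (g 0 0 * g 1 1 - g 0 1 * g 1 0) ^ 2 * ptX a := by
    simp only [ptX, pullX_apply]
    ring
  rw [h2, h, one_pow, one_mul]

/-- The discriminant with respect to `x` is invariant under unimodular changes of `x`. -/
theorem discX_pullX (g : SpecialLinearGroup (Fin 2) ℂ) (a : Matrix (Fin 3) (Fin 3) ℂ) :
    discX (pullX g a) = discX a := by
  have h := specialLinearGroup_det_eq g
  have h2 : discX (pullX g a) = C ((g 0 0 * g 1 1 - g 0 1 * g 1 0) ^ 2) * discX a := by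
    simp only [discX, pullX_apply, map_add, map_mul, map_pow, map_sub, map_ofNat]
    ring
  rw [h2, h, one_pow, C_1, one_mul]

/-- The matrix of the biquadratic form after the substitution `x ↦ g₁ x`, `y ↦ g₂ y`. -/
def pullback (g₁ g₂ : SpecialLinearGroup (Fin 2) ℂ) (a : Matrix (Fin 3) (Fin 3) ℂ) :
    Matrix (Fin 3) (Fin 3) ℂ := pullX g₁ (pullX g₂ a.transpose).transpose

theorem biform_transpose (a : Matrix (Fin 3) (Fin 3) ℂ) (u v : Fin 2 → ℂ) :
    biform a.transpose u v = biform a v u := by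
  simp only [biform_eq, Matrix.transpose_apply]
  ring

theorem biform_pullback (g₁ g₂ : SpecialLinearGroup (Fin 2) ℂ) (a : Matrix (Fin 3) (Fin 3) ℂ)
    (u v : Fin 2 → ℂ) : biform (pullback g₁ g₂ a) u v = biform a (g₁ • u) (g₂ • v) := by
  rw [pullback, biform_pullX, biform_transpose, biform_pullX, biform_transpose]

theorem ptX_transpose (a : Matrix (Fin 3) (Fin 3) ℂ) : ptX a.transpose = ptX a := by
  simp only [ptX, Matrix.transpose_apply]
  ring

theorem ptX_pullback (g₁ g₂ : SpecialLinearGroup (Fin 2) ℂ) (a : Matrix (Fin 3) (Fin 3) ℂ) :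
    ptX (pullback g₁ g₂ a) = ptX a := by
  rw [pullback, ptX_pullX, ptX_transpose, ptX_pullX, ptX_transpose]

theorem ptY_pullback (g₁ g₂ : SpecialLinearGroup (Fin 2) ℂ) (a : Matrix (Fin 3) (Fin 3) ℂ) :
    ptY (pullback g₁ g₂ a) = ptY a := by
  rw [pullback, ptY_pullX, ptY, Matrix.det_transpose, ← ptY, ptY_pullX, ptY, Matrix.det_transpose,
    ptY]

theorem invD_pullback (g₁ g₂ : SpecialLinearGroup (Fin 2) ℂ) (a : Matrix (Fin 3) (Fin 3) ℂ) :
    invD (pullback g₁ g₂ a) = invD a := by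
  rw [invD, pullback, discX_pullX, ← invD, invD_eq_discY, discY, Matrix.transpose_transpose,
    discX_pullX, invD_eq_discY, discY]

theorem invE_pullback (g₁ g₂ : SpecialLinearGroup (Fin 2) ℂ) (a : Matrix (Fin 3) (Fin 3) ℂ) :
    invE (pullback g₁ g₂ a) = invE a := by
  rw [invE, pullback, discX_pullX, ← invE, invE_eq_discY, discY, Matrix.transpose_transpose,
    discX_pullX, invE_eq_discY, discY]

theorem IsSmoothCubic.pullback {a : Matrix (Fin 3) (Fin 3) ℂ} (hs : IsSmoothCubic a)
    (g₁ g₂ : SpecialLinearGroup (Fin 2) ℂ) : IsSmoothCubic (pullback g₁ g₂ a) := by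
  rwa [IsSmoothCubic, cubicForm, invD_pullback, invE_pullback]

theorem nsmul_weierstrassPoint_pullback {a : Matrix (Fin 3) (Fin 3) ℂ} (hs : IsSmoothCubic a)
    (g₁ g₂ : SpecialLinearGroup (Fin 2) ℂ) (n : ℕ) :
    n • weierstrassPoint (Biquadratic.pullback g₁ g₂ a) (hs.pullback g₁ g₂) = 0 ↔
      n • weierstrassPoint a hs = 0 := by
  have hW : weierstrass (Biquadratic.pullback g₁ g₂ a) = weierstrass a := by
    rw [weierstrass, weierstrass, invD_pullback, invE_pullback]
  have key (W W' : WeierstrassCurve.Affine ℂ) (x y x' y' : ℂ) (h : W.Nonsingular x y)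
      (h' : W'.Nonsingular x' y') (e : W = W') (ex : x = x') (ey : y = y') :
      n • WeierstrassCurve.Affine.Point.some x y h = 0 ↔
        n • WeierstrassCurve.Affine.Point.some x' y' h' = 0 := by
    subst e ex ey
    rfl
  exact key _ _ _ _ _ _ _ _ hW (ptX_pullback g₁ g₂ a) (by rw [ptY_pullback])

/-! ### Reduction to the normal form -/

/-- Every nonzero vector is the image of `(0, 1)` under a unimodular matrix. -/
theorem exists_specialLinearGroup {v : Fin 2 → ℂ} (hv : v ≠ 0) :
    ∃ g : SpecialLinearGroup (Fin 2) ℂ, g 0 1 = v 0 ∧ g 1 1 = v 1 := by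
  by_cases h0 : v 0 = 0
  · have h1 : v 1 ≠ 0 := fun h1 => hv (by ext i; fin_cases i <;> simp [h0, h1])
    exact ⟨⟨!![(v 1)⁻¹, v 0; 0, v 1], by simp [Matrix.det_fin_two, h1]⟩, rfl, rfl⟩
  · exact ⟨⟨!![0, v 0; -(v 0)⁻¹, v 1], by simp [Matrix.det_fin_two, h0]⟩, rfl, rfl⟩

theorem exists_double_root {A B C : ℂ} (h : B ^ 2 - 4 * A * C = 0) :
    ∃ (c : ℂ) (p : Fin 2 → ℂ), p ≠ 0 ∧ ∀ z : Fin 2 → ℂ,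
      A * z 1 ^ 2 + B * z 1 * z 0 + C * z 0 ^ 2 = c * (p 0 * z 1 - p 1 * z 0) ^ 2 := by
  by_cases hA : A = 0
  · subst hA
    have hB : B = 0 := by
      rw [← sq_eq_zero_iff]
      linear_combination h
    refine ⟨C, ![0, 1], infPt_ne_zero, fun z => ?_⟩
    rw [hB]
    simp
  · refine ⟨A, ![1, -B / (2 * A)], finPt_ne_zero _, fun z => ?_⟩
    simp only [Matrix.cons_val_zero, Matrix.cons_val_one]
    field_simp
    linear_combination (-z 0 ^ 2) * h

/-- The discriminant, a binary quartic form, has a zero on the projective line. -/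
theorem exists_discriminant_zero (a : Matrix (Fin 3) (Fin 3) ℂ) :
    ∃ v : Fin 2 → ℂ, v ≠ 0 ∧
      (a 1 2 * v 1 ^ 2 + a 1 1 * v 1 * v 0 + a 1 0 * v 0 ^ 2) ^ 2
        - 4 * (a 2 2 * v 1 ^ 2 + a 2 1 * v 1 * v 0 + a 2 0 * v 0 ^ 2)
          * (a 0 2 * v 1 ^ 2 + a 0 1 * v 1 * v 0 + a 0 0 * v 0 ^ 2) = 0 := by
  by_cases h4 : (discX a).coeff 4 = 0
  · rw [(discX_coeff a).2.2.2.2] at h4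
    refine ⟨![0, 1], infPt_ne_zero, ?_⟩
    simp only [Matrix.cons_val_zero, Matrix.cons_val_one]
    linear_combination h4
  · have hdeg : (discX a).degree ≠ 0 := by
      intro h
      have := le_degree_of_ne_zero h4
      rw [h] at this
      exact absurd this (by decide)
    obtain ⟨y, hy⟩ := IsAlgClosed.exists_root (discX a) hdeg
    refine ⟨![1, y], finPt_ne_zero y, ?_⟩
    simp only [IsRoot, discX, eval_sub, eval_pow, eval_add, eval_mul, eval_C, eval_X,
      eval_ofNat] at hy
    simp only [Matrix.cons_val_zero, Matrix.cons_val_one]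
    linear_combination hy

theorem exists_isNormalForm_pullback {a : Matrix (Fin 3) (Fin 3) ℂ} (hs : IsSmoothCubic a) :
    ∃ g₁ g₂ : SpecialLinearGroup (Fin 2) ℂ, IsNormalForm (pullback g₁ g₂ a) := by
  obtain ⟨v, hv0, hv⟩ := exists_discriminant_zero a
  obtain ⟨c, p, hp0, hp⟩ := exists_double_root hv
  obtain ⟨g₂, h2, h2'⟩ := exists_specialLinearGroup hv0
  obtain ⟨g₁, h1, h1'⟩ := exists_specialLinearGroup hp0
  have hg : g₂ • ![0, 1] = v := by
    ext i
    fin_cases i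
    · simpa [smul_apply_zero] using h2
    · simpa [smul_apply_one] using h2'
  have hdet := specialLinearGroup_det_eq g₁
  have key (z : Fin 2 → ℂ) : biform (pullback g₁ g₂ a) z ![0, 1] = c * z 0 ^ 2 := by
    rw [biform_pullback, hg, biform_eq, hp, smul_apply_zero, smul_apply_one, ← h1, ← h1']
    linear_combination (c * z 0 ^ 2 * (g₁ 0 0 * g₁ 1 1 - g₁ 0 1 * g₁ 1 0 + 1)) * hdet
  -- three values of the quadratic form determine its two leading coefficients
  have k0 := key ![0, 1]
  have k1 := key ![1, 1]
  have k2 := key ![1, -1]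
  simp [biform_eq] at k0 k1 k2
  exact ⟨g₁, g₂, hs.pullback g₁ g₂, k0, by linear_combination (k1 - k2) / 2⟩

theorem qrt_pow_eq_one_iff (a : Matrix (Fin 3) (Fin 3) ℂ) (hs : IsSmoothCubic a) (n : ℕ) :
    qrt a ^ n = 1 ↔ translation a hs ^ n = 1 := by
  obtain ⟨g₁, g₂, ha⟩ := exists_isNormalForm_pullback hs
  rw [← qrt_pow_eq_one_iff_of_biform_eq (biform_pullback g₁ g₂ a), ha.qrt_pow_eq_one_iff,
    nsmul_weierstrassPoint_pullback hs, translation_pow_eq_one_iff]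

theorem orderOf_qrt (a : Matrix (Fin 3) (Fin 3) ℂ) (hs : IsSmoothCubic a) :
    orderOf (qrt a) = orderOf (translation a hs) :=
  orderOf_eq_orderOf_iff.2 (qrt_pow_eq_one_iff a hs)

end

end Biquadratic

open Biquadratic in
theorem mainTheorem1 :
    (∀ (a : Matrix (Fin 3) (Fin 3) ℂ) (hs : IsSmoothCubic a),
      -- the QRT map and the translation have the same order
      (∀ n : ℕ, orderOf (qrt a) = n ↔ orderOf (translation a hs) = n) ∧
      -- order two
      (orderOf (translation a hs) = 2 ↔ a.det = 0) ∧
      -- for `det ≠ 0`: the Hankel criteria for the `n`-th iterate to be the identity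
      (a.det ≠ 0 → ∀ k : ℕ, 1 ≤ k →
        ((translation a hs) ^ (2 * k + 1) = 1 ↔ hankelDet a 2 k = 0)) ∧
      (a.det ≠ 0 → ∀ k : ℕ, 2 ≤ k →
        ((translation a hs) ^ (2 * k) = 1 ↔ hankelDet a 3 (k - 1) = 0)) ∧
      -- exact order `n`: the condition of index `n` holds, and that of no proper divisor of `n`
      (∀ n : ℕ, 1 ≤ n →
        (orderOf (translation a hs) = n ↔
          CayleyCondition a n ∧ ∀ m : ℕ, m ∣ n → m < n → ¬ CayleyCondition a m))) ∧
    -- the Taylor coefficients are rational functions of the entries of `a`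
    (∀ j : ℕ, ∃ p q : MvPolynomial (Fin 3 × Fin 3) ℚ,
      ∀ a : Matrix (Fin 3) (Fin 3) ℂ, IsSmoothCubic a → a.det ≠ 0 →
        MvPolynomial.aeval (fun ij : Fin 3 × Fin 3 => a ij.1 ij.2) q ≠ 0 ∧
        taylorCoeff a j =
          MvPolynomial.aeval (fun ij : Fin 3 × Fin 3 => a ij.1 ij.2) p /
            MvPolynomial.aeval (fun ij : Fin 3 × Fin 3 => a ij.1 ij.2) q) := by
  refine ⟨fun a hs => ⟨fun n => by rw [orderOf_qrt a hs], orderOf_translation_eq_two_iff a hs,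
    fun hd k _ => translation_pow_odd_eq_one_iff a hs hd k,
    fun hd k hk => translation_pow_even_eq_one_iff a hs hd (by omega),
    fun n hn => orderOf_translation_eq_iff a hs hn⟩, fun j => IsRationalInEntries.taylorCoeff j⟩
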